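/- Let $\mathcal G=(V,E)$ be a finite connected simple undirected graph with at least two vertices; write $u\sim v$ for adjacency and $\delta$ for the graph distance, with $\delta(A,B)=\inf_{x\in A,\,y\in B}\delta(x,y)$ for $A,B\subset V$ and $\inf\emptyset=\infty$. Let $a>0$ and let $w:[a,\infty)\to(0,\infty)$ be non-decreasing and differentiable, with $1/w$ Lebesgue integrable on $[a,\infty)$, and such that there are constants $\kappa>1$ and $\alpha>1$ with $$\kappa^{-1}t^{\alpha}\le w(t)\le\kappa t^{\alpha}\qquad\text{for all } t\ge a .$$ For $\ell=(\ell_v)_{v\in V}$ with $\ell_v\ge a$ for all $v$, the vertex-reinforced jump process $\mathrm{VRJP}(\ell,w)$ on $\mathcal G$, with arbitrary (possibly random) starting point, is the càdlàg process $\mathbf X=(X_t)_{t\ge0}$ on $V$ which, conditionally on its past, jumps at time $t$ from its current position to each neighbour $v$ of that position at rate $w(L(v,t))$, where $$L(v,t)=\ell_v+\int_0^t\mathbf 1_{\{X_s=v\}}\,ds .$$ That is: almost surely, $X$ is equal to $Y_n$ on $[\tau_n,\tau_{n+1})$ with $0=\tau_0<\tau_1<\cdots\to\infty$ and $Y_n\sim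 Y_{n+1}$ for all $n\ge0$; and for all $n\ge0$, $v\in V$ and $s\ge0$, with $W_n=\sum_{u\sim Y_n}w(L(u,\tau_n))$, $$\mathbb P\big(\tau_{n+1}-\tau_n>s,\ Y_{n+1}=v\ \big|\ \tau_0,Y_0,\dots,\tau_n,Y_n\big)=\mathbf 1_{\{v\sim Y_n\}}\,\frac{w(L(v,\tau_n))}{W_n}\,e^{-sW_n}\quad\text{a.s.}$$ For $U\subset V$ put $L(U,t)=\sum_{v\in U}L(v,t)$. Let $V^*=\{v\in V:\lim_{t\to\infty}L(v,t)=\infty\}$, and call the (vertex sets of the) connected components of the subgraph of $\mathcal G$ induced by $V^*$ clusters. Then there is a deterministic constant $\gamma_0>0$, depending only on $\mathcal G$ and $w$ (on $[a,\infty)$), such that for every such $\ell$ and every $\mathrm{VRJP}(\ell,w)$ on $\mathcal G$ the following holds almost surely: 1. if $V^*$ has more than one cluster, then $\delta(U,V^*\setminus U)=2$ for every cluster $U$; 2. for every cluster $U$ and every $i\in U$, $$\liminf_{t\to\infty}\frac{L(i,t)}{L(U,t)}\ge\gamma_0 .$$ -/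

import Mathlib

open MeasureTheory Filter Topology
open scoped NNReal

namespace VRJP

noncomputable section

/-- The local time `L(v,t) = ℓ_v + ∫_0^t 1{x_s = v} ds` at the vertex `v` by time `t`, along a
path `x`, with initial local times `ℓ`. -/
def localTime {V : Type*} (ℓ : V → ℝ) (x : ℝ≥0 → V) (v : V) (t : ℝ≥0) : ℝ :=
  ℓ v + ∫ s in (0 : ℝ)..(t : ℝ), Set.indicator {r : ℝ | x r.toNNReal = v} (fun _ => (1 : ℝ)) s

/-- The local time `L(U,t) = ∑_{v ∈ U} L(v,t)` of a set `U` of vertices. -/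
def setLocalTime {V : Type*} [Fintype V] (ℓ : V → ℝ) (x : ℝ≥0 → V) (U : Set V) (t : ℝ≥0) : ℝ :=
  ∑ v, U.indicator (fun u => localTime ℓ x u t) v

/-- `V*`, the set of vertices `i` with `L(i,∞) = ∞` along the path `x`. -/
def unboundedSet {V : Type*} (ℓ : V → ℝ) (x : ℝ≥0 → V) : Set V :=
  {i | Tendsto (localTime ℓ x i) atTop atTop}

/-- `U` is a cluster of `S`: the vertex set of a connected component of the subgraph of `G`
induced by `S`. -/
def IsCluster {V : Type*} (G : SimpleGraph V) (S U : Set V) : Prop :=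
  ∃ c : (G.induce S).ConnectedComponent, U = Subtype.val '' c.supp

/-- The graph distance `δ(A,B)` between two sets of vertices, with `inf ∅ = ∞`. -/
def setDist {V : Type*} (G : SimpleGraph V) (A B : Set V) : ℕ∞ :=
  ⨅ x ∈ A, ⨅ y ∈ B, G.edist x y

/-- The rate `1{i ∼ v} w(L(v,t))` at which the process, when at the vertex `i` at time `t`,
jumps to the vertex `v`. -/
def jumpRate {V : Type*} (G : SimpleGraph V) (ℓ : V → ℝ) (w : ℝ → ℝ) (x : ℝ≥0 → V)
    (i : V) (t : ℝ≥0) (v : V) : ℝ :=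
  Set.indicator {u | G.Adj i u} (fun u => w (localTime ℓ x u t)) v

/-- The history of the process up to and including its `n`-th jump: the σ-algebra generated by the
jump times `τ_0, …, τ_n` and the visited vertices `Y_0, …, Y_n`. -/
@[reducible] def history {Ω V : Type*} (τ : ℕ → Ω → ℝ≥0) (Y : ℕ → Ω → V) (n : ℕ) : MeasurableSpace Ω :=
  ⨆ k ∈ Set.Iic n, (MeasurableSpace.comap (τ k) inferInstance ⊔ MeasurableSpace.comap (Y k) ⊤)

/-- `X` is a vertex-reinforced jump process VRJP(`ℓ`, `w`) on the finite graph `G`, with an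
arbitrary (possibly random) starting point.

Almost surely, the path is càdlàg and jumps between neighbours: it is constant, equal to `Y_n`, on
`[τ_n, τ_{n+1})`, where `0 = τ_0 < τ_1 < ⋯ → ∞` are the jump times.  Conditionally on the past,
it jumps from its current position to each neighbour `v` at rate `w(L(v,t))`.  There are no loops,
so these rates do not change between two jumps; hence, given the history up to the `n`-th jump, the
holding time `τ_{n+1} - τ_n` is exponential with parameter the total rate at time `τ_n`, and,
independently of it, the next position is chosen proportionally to the rates at time `τ_n`. -/
def IsVRJP {Ω V : Type*} [MeasurableSpace Ω] [Fintype V] (G : SimpleGraph V) (ℓ : V → ℝ)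
    (w : ℝ → ℝ) (μ : Measure Ω) (X : ℝ≥0 → Ω → V) : Prop :=
  (∀ t, Measurable[_, ⊤] (X t)) ∧
  ∃ (τ : ℕ → Ω → ℝ≥0) (Y : ℕ → Ω → V),
    (∀ n, Measurable (τ n)) ∧ (∀ n, Measurable[_, ⊤] (Y n)) ∧
    (∀ᵐ ω ∂μ, τ 0 ω = 0 ∧ StrictMono (fun n => τ n ω) ∧
      Tendsto (fun n => τ n ω) atTop atTop ∧
      (∀ n, G.Adj (Y n ω) (Y (n + 1) ω)) ∧
      ∀ n t, τ n ω ≤ t → t < τ (n + 1) ω → X t ω = Y n ω) ∧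
    ∀ (n : ℕ) (v : V) (s : ℝ≥0),
      μ[Set.indicator {ω | τ n ω + s < τ (n + 1) ω ∧ Y (n + 1) ω = v} (fun _ => (1 : ℝ)) |
          history τ Y n]
        =ᵐ[μ] fun ω =>
          let rate := jumpRate G ℓ w (fun t => X t ω) (Y n ω) (τ n ω)
          rate v / (∑ u, rate u) * Real.exp (-(s * ∑ u, rate u))

end

end VRJP

/-!
The process is studied through its jump chain: after `n` jumps it has local times `L^n`, sits at
`Y_n`, and holds there for an exponential time.  Put `c_{xy} = w(L_x) w(L_y)` on the edges; these
are the conductances for which the chain with frozen local times is reversible.  Measure local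
times in the scale `F(x) = ∫_a^x 1/w`, which is bounded.

*Comparison along an edge.*  Fix an edge `ik` and let `f` be the potential of the unit current from
`i` to `k` for the current conductances (`potential`).  Since `Σ_y c_{xy} (f_x - f_y) = δ_i - δ_k`,
the function `f` solves the Poisson equation for the difference of the rates of growth of `F(L_i)`
and `F(L_k)`.  Hence `F(L_i) - F(L_k) + f(Y)` is a martingale up to the change of `f(Y)` caused by
the growth of the local times.  Three estimates from the theory of electrical networks suffice.
* The energy of the unit current, which is the potential difference `f_i`, is at most `1 / c_{ik}`;
  so `f` itself is negligible.
* When the weight at `v` grows, `f_v` changes by at most a multiple of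
  `c_{ik}^{-1/2} (w_v^{-1/2} - w_v'^{-1/2})`, which telescopes
  (`abs_potential_update_sub_le_inv_sqrt`); the total drift after time `n` is
  `O(c_{ik}^{-1/2})`.
* The conditional variance of a martingale step is at most the mean growth of `Σ_v F(L_v)` divided
  by `c_{ik}`, by the energy bound again (`stepMean_sq_le`); so the martingale started at time `n`
  is `O(c_{ik}^{-1/2})` in mean square (`lintegral_sq_sum_chainIncr_le`).

If `L_k ≥ Γ L_i` with `Γ` large, then `F(∞) - F(L_k)` is at most half of `F(∞) - F(L_i)`, whereas
`c_{ik}^{-1/2} ≤ 1 / w(L_i)` is negligible against `F(∞) - F(L_i)`, which is of order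
`L_i / w(L_i)`.  So, by Chebyshev's inequality, `L_i` remains bounded with conditional probability
`1 - O(L_i^{-2})`.  Decomposing according to the first such time at which `L_i` exceeds a large
level, almost surely `L_i → ∞` forces `L_k < Γ L_i` eventually (`ae_eventually_chainTime_lt`).
Chaining this along the walks inside a cluster gives the lower bound on `L(i,t) / L(U,t)`.

*Distance between clusters.*  The mean number of jumps from `x` to `y` while `L_x` and `L_y` are at
most `K` is finite, because such a jump has rate at most `w(K)` and the time available for it is
bounded (`ae_not_frequently_jump`).  So eventually no jump joins two vertices with bounded local
times, and the last exit from a cluster before a visit to another one goes through a single vertex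
outside `V*`.
-/

namespace VRJP

noncomputable section

open scoped Classical

/-! ### Potentials of a unit current in a weighted graph -/

section Network

variable {V : Type*} (G : SimpleGraph V)

/-- The conductance of the edge `xy` when the vertices carry the weights `q`: the product of the
weights of the endpoints, and zero off the edges. -/
def cond (q : V → ℝ) (x y : V) : ℝ := if G.Adj x y then q x * q y else 0

variable {G}

lemma cond_comm (q : V → ℝ) (x y : V) : cond G q x y = cond G q y x := by
  simp only [cond, G.adj_comm x y, mul_comm]

lemma cond_self (q : V → ℝ) (x : V) : cond G q x x = 0 := by simp [cond]

lemma cond_nonneg {q : V → ℝ} (hq : ∀ v, 0 < q v) (x y : V) : 0 ≤ cond G q x y := by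
  unfold cond
  split_ifs
  · exact (mul_pos (hq x) (hq y)).le
  · exact le_rfl

lemma cond_of_adj {x y : V} (q : V → ℝ) (h : G.Adj x y) : cond G q x y = q x * q y := by
  simp [cond, h]

variable [Fintype V] (G)

/-- The net current leaving `x` when the network has potential `f`. -/
def current (q f : V → ℝ) (x : V) : ℝ := ∑ y, cond G q x y * (f x - f y)

/-- The matrix of `f ↦ current G q f + f k • δ_k`, the graph Laplacian grounded at `k`. -/
def groundedLaplacian (q : V → ℝ) (k : V) : Matrix V V ℝ := fun x y =>
  (if x = y then (∑ z, cond G q x z) + (if x = k then 1 else 0) else 0) - cond G q x y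

/-- The potential, vanishing at `k`, of the unit current which enters at `i` and leaves
at `k`. -/
def potential (q : V → ℝ) (i k : V) : V → ℝ :=
  (groundedLaplacian G q k)⁻¹.mulVec (Pi.single i 1 - Pi.single k 1)

variable {G}

lemma sum_mul_current (q f g : V → ℝ) :
    ∑ x, g x * current G q f x
      = (∑ x, ∑ y, cond G q x y * ((f x - f y) * (g x - g y))) / 2 := by
  have h1 : ∑ x, g x * current G q f x = ∑ x, ∑ y, cond G q x y * ((f x - f y) * g x) := by
    refine Finset.sum_congr rfl fun x _ => ?_
    rw [current, Finset.mul_sum]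
    exact Finset.sum_congr rfl fun y _ => by ring
  have h2 : ∑ x, ∑ y, cond G q x y * ((f x - f y) * g x)
      = ∑ x, ∑ y, cond G q x y * ((f y - f x) * g y) := by
    rw [Finset.sum_comm]
    exact Finset.sum_congr rfl fun y _ => Finset.sum_congr rfl fun x _ => by rw [cond_comm]
  have h3 : ∑ x, ∑ y, cond G q x y * ((f x - f y) * (g x - g y))
      = ∑ x, ∑ y, cond G q x y * ((f x - f y) * g x)
        + ∑ x, ∑ y, cond G q x y * ((f y - f x) * g y) := by
    rw [← Finset.sum_add_distrib]
    refine Finset.sum_congr rfl fun x _ => ?_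
    rw [← Finset.sum_add_distrib]
    exact Finset.sum_congr rfl fun y _ => by ring
  rw [h1, h3, ← h2]
  ring

lemma sum_mul_current_comm (q f g : V → ℝ) :
    ∑ x, g x * current G q f x = ∑ x, f x * current G q g x := by
  rw [sum_mul_current, sum_mul_current]
  congr 1
  exact Finset.sum_congr rfl fun x _ => Finset.sum_congr rfl fun y _ => by ring

lemma sum_current (q f : V → ℝ) : ∑ x, current G q f x = 0 := by
  have h := sum_mul_current (G := G) q f (fun _ => 1)
  simpa using h

lemma current_sub (q f g : V → ℝ) (x : V) :
    current G q (f - g) x = current G q f x - current G q g x := by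
  simp only [current, ← Finset.sum_sub_distrib, Pi.sub_apply]
  exact Finset.sum_congr rfl fun y _ => by ring

/-- The maximum principle: a potential which is subharmonic off `v` is maximal at `v`. -/
lemma le_of_current_nonpos (hG : G.Connected) {q : V → ℝ} (hq : ∀ v, 0 < q v) {f : V → ℝ} {v : V}
    (hf : ∀ x, x ≠ v → current G q f x ≤ 0) (x : V) : f x ≤ f v := by
  obtain ⟨m, -, hm⟩ := Finset.exists_max_image (Finset.univ : Finset V) f ⟨v, Finset.mem_univ v⟩
  have hstep : ∀ y z, G.Adj y z → y ≠ v → f y = f m → f z = f m := by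
    intro y z hyz hyv hy
    have hnn : ∀ u ∈ (Finset.univ : Finset V), 0 ≤ cond G q y u * (f y - f u) := fun u _ =>
      mul_nonneg (cond_nonneg hq _ _) (by rw [hy]; linarith [hm u (Finset.mem_univ u)])
    have h1 := Finset.single_le_sum hnn (Finset.mem_univ z)
    have h2 : cond G q y z * (f y - f z) ≤ 0 := h1.trans (hf y hyv)
    rw [cond_of_adj q hyz] at h2
    have h3 := hm z (Finset.mem_univ z)
    have h4 := mul_pos (hq y) (hq z)
    nlinarith
  have key : f m = f v := by
    obtain ⟨p⟩ := hG.preconnected m v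
    suffices h : ∀ (y z : V) (p : G.Walk y z), z = v → f y = f m → f v = f m from
      (h m v p rfl rfl).symm
    intro y z p
    induction p with
    | nil => intro h h'; rw [← h, h']
    | @cons y z t hyz p ih =>
      intro h hy
      by_cases hyv : y = v
      · rw [← hyv, hy]
      · exact ih h (hstep y z hyz hyv hy)
  rw [← key]
  exact hm x (Finset.mem_univ x)

lemma groundedLaplacian_mulVec (q : V → ℝ) (k : V) (f : V → ℝ) (x : V) :
    (groundedLaplacian G q k).mulVec f x = current G q f x + if x = k then f k else 0 := by
  simp only [Matrix.mulVec, dotProduct, groundedLaplacian, sub_mul, ite_mul, zero_mul,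
    Finset.sum_sub_distrib, Finset.sum_ite_eq, Finset.mem_univ, if_true, current, mul_sub,
    add_mul, Finset.sum_mul, one_mul]
  by_cases h : x = k
  · subst h; simp; ring
  · simp [h]

lemma isUnit_groundedLaplacian (hG : G.Connected) {q : V → ℝ} (hq : ∀ v, 0 < q v) (k : V) :
    IsUnit (groundedLaplacian G q k) := by
  rw [← Matrix.mulVec_injective_iff_isUnit]
  intro f g hfg
  have h0 : (groundedLaplacian G q k).mulVec (f - g) = 0 := by
    rw [Matrix.mulVec_sub, sub_eq_zero]; exact hfg
  set d := f - g with hd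
  have h1 : ∀ x, current G q d x + (if x = k then d k else 0) = 0 := fun x => by
    rw [← groundedLaplacian_mulVec, h0]; rfl
  have h2 : d k = 0 := by
    have h := Finset.sum_congr (s₁ := (Finset.univ : Finset V)) rfl (fun x _ => h1 x)
    simpa [Finset.sum_add_distrib, sum_current] using h
  have h3 : ∀ x, current G q d x = 0 := fun x => by simpa [h2] using h1 x
  have h4 : ∀ x, d x ≤ d k := le_of_current_nonpos hG hq fun x _ => (h3 x).le
  have h5 : ∀ x, (0 - d) x ≤ (0 - d) k := le_of_current_nonpos hG hq fun x _ => by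
    rw [current_sub, h3 x]; simp [current]
  have h6 : d = 0 := by
    funext x
    have := h4 x
    have := h5 x
    simp only [Pi.sub_apply, Pi.zero_apply] at *
    linarith
  exact sub_eq_zero.1 h6

lemma potential_spec (hG : G.Connected) {q : V → ℝ} (hq : ∀ v, 0 < q v) (i k : V) :
    potential G q i k k = 0 ∧ ∀ x, current G q (potential G q i k) x
      = (if x = i then 1 else 0) - (if x = k then 1 else 0) := by
  set f := potential G q i k with hf
  have h0 : (groundedLaplacian G q k).mulVec f = Pi.single i 1 - Pi.single k 1 := by
    rw [hf, potential, Matrix.mulVec_mulVec, Matrix.mul_nonsing_inv _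
      ((Matrix.isUnit_iff_isUnit_det _).1 (isUnit_groundedLaplacian hG hq k)), Matrix.one_mulVec]
  have h1 : ∀ x, current G q f x + (if x = k then f k else 0)
      = (if x = i then 1 else 0) - (if x = k then 1 else 0) := fun x => by
    rw [← groundedLaplacian_mulVec, h0]; simp [Pi.single_apply]
  have h2 : f k = 0 := by
    have h := Finset.sum_congr (s₁ := (Finset.univ : Finset V)) rfl (fun x _ => h1 x)
    simpa [Finset.sum_add_distrib, sum_current] using h
  exact ⟨h2, fun x => by simpa [h2] using h1 x⟩

lemma potential_self (hG : G.Connected) {q : V → ℝ} (hq : ∀ v, 0 < q v) (i k : V) :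
    potential G q i k k = 0 := (potential_spec hG hq i k).1

lemma current_potential (hG : G.Connected) {q : V → ℝ} (hq : ∀ v, 0 < q v) (i k x : V) :
    current G q (potential G q i k) x
      = (if x = i then 1 else 0) - (if x = k then 1 else 0) := (potential_spec hG hq i k).2 x

lemma potential_le (hG : G.Connected) {q : V → ℝ} (hq : ∀ v, 0 < q v) (i k x : V) :
    potential G q i k x ≤ potential G q i k i :=
  le_of_current_nonpos hG hq (fun y hy => by
    rw [current_potential hG hq, if_neg hy]; split_ifs <;> norm_num) x

lemma potential_nonneg (hG : G.Connected) {q : V → ℝ} (hq : ∀ v, 0 < q v) (i k x : V) :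
    0 ≤ potential G q i k x := by
  have h : (0 - potential G q i k) x ≤ (0 - potential G q i k) k :=
    le_of_current_nonpos hG hq (fun y hy => by
      rw [current_sub, current_potential hG hq, if_neg hy]
      simp only [current, Pi.zero_apply, sub_zero, mul_zero, Finset.sum_const_zero]
      split_ifs <;> norm_num) x
  simp only [Pi.sub_apply, Pi.zero_apply, potential_self hG hq] at h
  linarith

/-- The energy dissipated by the unit current is the potential difference between its ends. -/
lemma energy_potential (hG : G.Connected) {q : V → ℝ} (hq : ∀ v, 0 < q v) (i k : V) :
    (∑ x, ∑ y, cond G q x y * ((potential G q i k x - potential G q i k y)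
      * (potential G q i k x - potential G q i k y))) / 2 = potential G q i k i := by
  rw [← sum_mul_current]
  simp only [current_potential hG hq, mul_sub, Finset.sum_sub_distrib]
  simp [potential_self hG hq]

lemma star_energy_le {q : V → ℝ} (hq : ∀ v, 0 < q v) (f : V → ℝ) (v : V) :
    ∑ u, cond G q v u * (f v - f u) ^ 2
      ≤ (∑ x, ∑ y, cond G q x y * ((f x - f y) * (f x - f y))) / 2 := by
  have hnn : ∀ x y, 0 ≤ cond G q x y * ((f x - f y) * (f x - f y)) := fun x y =>
    mul_nonneg (cond_nonneg hq x y) (mul_self_nonneg _)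
  have h1 : ∑ x, ∑ y, cond G q x y * ((f x - f y) * (f x - f y))
      = ∑ y, cond G q v y * ((f v - f y) * (f v - f y))
        + ∑ x ∈ Finset.univ.erase v, ∑ y, cond G q x y * ((f x - f y) * (f x - f y)) :=
    (Finset.add_sum_erase _ _ (Finset.mem_univ v)).symm
  have h2 : ∑ x ∈ Finset.univ.erase v, cond G q x v * ((f x - f v) * (f x - f v))
      ≤ ∑ x ∈ Finset.univ.erase v, ∑ y, cond G q x y * ((f x - f y) * (f x - f y)) :=
    Finset.sum_le_sum fun x _ =>
      Finset.single_le_sum (f := fun y => cond G q x y * ((f x - f y) * (f x - f y)))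
        (fun y _ => hnn x y) (Finset.mem_univ v)
  have h3 : ∑ x ∈ Finset.univ.erase v, cond G q x v * ((f x - f v) * (f x - f v))
      = ∑ u, cond G q v u * (f v - f u) ^ 2 := by
    rw [← Finset.add_sum_erase _ (fun u => cond G q v u * (f v - f u) ^ 2) (Finset.mem_univ v)]
    simp only [cond_self, zero_mul, zero_add]
    exact Finset.sum_congr rfl fun x _ => by rw [cond_comm]; ring
  have h4 : ∑ y, cond G q v y * ((f v - f y) * (f v - f y))
      = ∑ u, cond G q v u * (f v - f u) ^ 2 := Finset.sum_congr rfl fun u _ => by ring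
  rw [h1, h4]
  linarith

lemma potential_le_inv (hG : G.Connected) {q : V → ℝ} (hq : ∀ v, 0 < q v) {i k : V}
    (hik : G.Adj i k) : potential G q i k i ≤ (q i * q k)⁻¹ := by
  have h1 := star_energy_le (G := G) hq (potential G q i k) i
  rw [energy_potential hG hq] at h1
  have h2 := Finset.single_le_sum (f := fun u => cond G q i u
      * (potential G q i k i - potential G q i k u) ^ 2)
    (fun u _ => mul_nonneg (cond_nonneg hq i u) (sq_nonneg _)) (Finset.mem_univ k)
  simp only [cond_of_adj q hik, potential_self hG hq, sub_zero] at h2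
  have h3 := h2.trans h1
  have hc := mul_pos (hq i) (hq k)
  rcases (potential_nonneg hG hq i k i).eq_or_lt with h | h
  · rw [← h]; positivity
  · rw [← one_div, le_div_iff₀ hc]
    nlinarith

lemma star_energy_potential_le (hG : G.Connected) {q : V → ℝ} (hq : ∀ v, 0 < q v) {i k : V}
    (hik : G.Adj i k) (v : V) :
    ∑ u, cond G q v u * (potential G q i k v - potential G q i k u) ^ 2 ≤ (q i * q k)⁻¹ :=
  (star_energy_le hq _ v).trans ((energy_potential hG hq i k).le.trans
    (potential_le_inv hG hq hik))

/-- Multiplying the weight of `v` by a factor `ρ ≥ 1` changes the potential at `v` by at most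
`1 - 1 / ρ` times its largest variation along the edges at `v`.  Indeed the change is minus the
pairing, over the edges at `v`, of the added conductances times the old potential differences with
the differences of the new potential of the unit current from `v` to `k`; the latter unit current
leaves `v` through those very edges. -/
lemma abs_potential_update_sub_le (hG : G.Connected) {q q' : V → ℝ} (hq : ∀ v, 0 < q v)
    {i k v : V} (hqv : q v ≤ q' v) (hqu : ∀ u, u ≠ v → q' u = q u) {B : ℝ} (hB : 0 ≤ B)
    (hf : ∀ u, G.Adj v u → |potential G q i k v - potential G q i k u| ≤ B) :
    |potential G q' i k v - potential G q i k v| ≤ (1 - q v / q' v) * B := by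
  have hq'v : 0 < q' v := (hq v).trans_le hqv
  have hq' : ∀ u, 0 < q' u := fun u => by
    by_cases h : u = v
    · rw [h]; exact hq'v
    · rw [hqu u h]; exact hq u
  have hr : 0 ≤ 1 - q v / q' v := by
    rw [sub_nonneg]; exact (div_le_one hq'v).2 hqv
  by_cases hvk : v = k
  · subst hvk
    rw [potential_self hG hq, potential_self hG hq', sub_zero, abs_zero]
    exact mul_nonneg hr hB
  set f := potential G q i k with hfdef
  set f' := potential G q' i k with hfdef'
  set g := potential G q' v k with hgdef
  have e1 : f' v - f v = ∑ x, (f' - f) x * current G q' g x := by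
    simp only [hgdef, current_potential hG hq', mul_sub, Finset.sum_sub_distrib]
    simp [hfdef, hfdef', potential_self hG hq, potential_self hG hq']
  have e2 : ∑ x, (f' - f) x * current G q' g x
      = ∑ x, g x * current G q f x - ∑ x, g x * current G q' f x := by
    rw [← sum_mul_current_comm, ← Finset.sum_sub_distrib]
    refine Finset.sum_congr rfl fun x _ => ?_
    rw [current_sub, hfdef', hfdef, current_potential hG hq', current_potential hG hq, mul_sub]
  -- the conductances off the star of `v` are unchanged
  have hcond : ∀ x y, cond G q' x y - cond G q x y
      = (if x = v then (1 - q v / q' v) * cond G q' v y else 0)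
        + (if y = v then (1 - q v / q' v) * cond G q' v x else 0) := by
    intro x y
    have hedge : ∀ u, cond G q' v u - cond G q v u = (1 - q v / q' v) * cond G q' v u := by
      intro u
      unfold cond
      split_ifs with h
      · rw [hqu u h.ne']; field_simp
      · simp
    by_cases hx : x = v <;> by_cases hy : y = v
    · subst hx; subst hy; simp [cond_self]
    · subst hx; rw [if_pos rfl, if_neg hy, add_zero, hedge]
    · subst hy; rw [if_neg hx, if_pos rfl, zero_add, cond_comm, cond_comm q, hedge]
    · simp [hx, hy, cond, hqu x hx, hqu y hy]
  have e3 : ∑ x, g x * current G q' f x - ∑ x, g x * current G q f x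
      = (1 - q v / q' v) * ∑ u, cond G q' v u * ((f v - f u) * (g v - g u)) := by
    rw [sum_mul_current, sum_mul_current, ← sub_div, ← Finset.sum_sub_distrib]
    have : ∀ x, (∑ y, cond G q' x y * ((f x - f y) * (g x - g y))
        - ∑ y, cond G q x y * ((f x - f y) * (g x - g y)))
        = (if x = v then ∑ y, (1 - q v / q' v) * cond G q' v y * ((f v - f y) * (g v - g y)) else 0)
          + (1 - q v / q' v) * cond G q' v x * ((f v - f x) * (g v - g x)) := by
      intro x
      rw [← Finset.sum_sub_distrib]
      have h : ∀ y, cond G q' x y * ((f x - f y) * (g x - g y))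
          - cond G q x y * ((f x - f y) * (g x - g y))
          = (if x = v then (1 - q v / q' v) * cond G q' v y * ((f v - f y) * (g v - g y)) else 0)
            + (if y = v then (1 - q v / q' v) * cond G q' v x * ((f v - f x) * (g v - g x))
              else 0) := by
        intro y
        rw [← sub_mul, hcond]
        by_cases hx : x = v <;> by_cases hy : y = v
        · subst hx; subst hy; simp
        · subst hx; simp [hy]
        · subst hy; simp only [if_neg hx, if_true]; ring
        · simp [hx, hy]
      simp only [h, Finset.sum_add_distrib, Finset.sum_ite_eq', Finset.mem_univ, if_true]
      congr 1
      split_ifs <;> simp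
    simp only [this, Finset.sum_add_distrib, Finset.sum_ite_eq', Finset.mem_univ, if_true,
      Finset.mul_sum]
    rw [add_self_div_two]
    exact Finset.sum_congr rfl fun u _ => by ring
  have hcur : ∑ u, cond G q' v u * (g v - g u) = 1 := by
    have := current_potential hG hq' v k v
    rw [if_pos rfl, if_neg hvk, sub_zero] at this
    exact this
  have e4 : |∑ u, cond G q' v u * ((f v - f u) * (g v - g u))| ≤ B := by
    calc |∑ u, cond G q' v u * ((f v - f u) * (g v - g u))|
        ≤ ∑ u, |cond G q' v u * ((f v - f u) * (g v - g u))| := Finset.abs_sum_le_sum_abs _ _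
      _ ≤ ∑ u, B * (cond G q' v u * (g v - g u)) := by
          refine Finset.sum_le_sum fun u _ => ?_
          by_cases h : G.Adj v u
          · have hg : 0 ≤ g v - g u := sub_nonneg.2 (potential_le hG hq' v k u)
            have hc := cond_nonneg (G := G) hq' v u
            rw [abs_mul, abs_mul, abs_of_nonneg hg, abs_of_nonneg hc]
            calc cond G q' v u * (|f v - f u| * (g v - g u))
                = |f v - f u| * (cond G q' v u * (g v - g u)) := by ring
              _ ≤ _ := mul_le_mul_of_nonneg_right (hf u h) (mul_nonneg hc hg)
          · simp [cond, h]
      _ = B := by rw [← Finset.mul_sum, hcur, mul_one]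
  have e5 : f' v - f v = -((1 - q v / q' v) * ∑ u, cond G q' v u * ((f v - f u) * (g v - g u))) := by
    rw [e1, e2, ← e3]; ring
  rw [e5, abs_neg, abs_mul, abs_of_nonneg hr]
  exact mul_le_mul_of_nonneg_left e4 hr

lemma abs_potential_sub_le_inv_sqrt (hG : G.Connected) {q : V → ℝ} (hq : ∀ v, 0 < q v) {i k v u : V}
    (hik : G.Adj i k) (hvu : G.Adj v u) :
    |potential G q i k v - potential G q i k u| ≤ 1 / √(q i * q k * (q v * q u)) := by
  have h1 := star_energy_potential_le hG hq hik v
  have h2 := (Finset.single_le_sum (f := fun u => cond G q v u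
      * (potential G q i k v - potential G q i k u) ^ 2)
    (fun u _ => mul_nonneg (cond_nonneg hq v u) (sq_nonneg _)) (Finset.mem_univ u)).trans h1
  simp only [cond_of_adj q hvu] at h2
  have hc := mul_pos (hq i) (hq k)
  have hd := mul_pos (hq v) (hq u)
  rw [← Real.sqrt_sq_eq_abs, one_div, ← Real.sqrt_inv]
  apply Real.sqrt_le_sqrt
  rw [mul_inv, ← div_eq_mul_inv, le_div_iff₀ hd]
  linarith

/-- When the weight of `v` grows from `q v` to `q' v`, the change of the potential at `v` is
controlled by the decrease of the inverse square root of that weight, which is a telescoping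
quantity. -/
lemma abs_potential_update_sub_le_inv_sqrt (hG : G.Connected) {q q' : V → ℝ} {m : ℝ} (hm : 0 < m)
    (hq : ∀ v, m ≤ q v) {i k v : V} (hik : G.Adj i k) (hqv : q v ≤ q' v)
    (hqu : ∀ u, u ≠ v → q' u = q u) :
    |potential G q' i k v - potential G q i k v|
      ≤ 2 / √(q i * q k * m) * (1 / √(q v) - 1 / √(q' v)) := by
  have hq0 : ∀ v, 0 < q v := fun v => hm.trans_le (hq v)
  have hc := mul_pos (hq0 i) (hq0 k)
  have hv := hq0 v
  have hv' := hv.trans_le hqv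
  have h1 := abs_potential_update_sub_le hG hq0 (i := i) (k := k) hqv hqu
    (B := 1 / √(q i * q k * (q v * m))) (by positivity) (fun u hu =>
      (abs_potential_sub_le_inv_sqrt hG hq0 hik hu).trans (by
        apply one_div_le_one_div_of_le (by positivity)
        apply Real.sqrt_le_sqrt
        exact mul_le_mul_of_nonneg_left (mul_le_mul_of_nonneg_left (hq u) hv.le) hc.le))
  refine h1.trans ?_
  have es : √(q i * q k * (q v * m)) = √(q i * q k * m) * √(q v) := by
    rw [← Real.sqrt_mul (by positivity)]; congr 1; ring
  have hs : 0 < √(q v) := Real.sqrt_pos.2 hv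
  have hs' : 0 < √(q' v) := Real.sqrt_pos.2 hv'
  have hS : 0 < √(q i * q k * m) := Real.sqrt_pos.2 (by positivity)
  have hle : √(q v) ≤ √(q' v) := Real.sqrt_le_sqrt hqv
  have e1 : q v / q' v = (√(q v) / √(q' v)) ^ 2 := by
    rw [div_pow, Real.sq_sqrt hv.le, Real.sq_sqrt hv'.le]
  rw [es, e1]
  set r := √(q v) / √(q' v) with hr
  have hr0 : 0 ≤ r := by positivity
  have hr1 : r ≤ 1 := (div_le_one hs').2 hle
  have e2 : 1 / √(q v) - 1 / √(q' v) = (1 - r) / √(q v) := by rw [hr]; field_simp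
  rw [e2]
  have e3 : (1 - r ^ 2) * (1 / (√(q i * q k * m) * √(q v)))
      = (1 - r ^ 2) / (√(q i * q k * m) * √(q v)) := by ring
  have e4 : 2 / √(q i * q k * m) * ((1 - r) / √(q v))
      = (2 * (1 - r)) / (√(q i * q k * m) * √(q v)) := by ring
  rw [e3, e4]
  apply div_le_div_of_nonneg_right _ (by positivity)
  nlinarith

lemma measurable_potential (i k x : V) : Measurable fun q : V → ℝ => potential G q i k x := by
  have hcond : ∀ x y, Continuous fun q : V → ℝ => cond G q x y := by
    intro x y
    unfold cond
    split_ifs <;> fun_prop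
  have hA : Continuous fun q : V → ℝ => groundedLaplacian G q k := by
    refine continuous_matrix fun x y => ?_
    unfold groundedLaplacian
    refine Continuous.sub ?_ (hcond x y)
    split_ifs
    · exact (continuous_finsetSum _ fun z _ => hcond x z).add continuous_const
    · exact (continuous_finsetSum _ fun z _ => hcond x z).add continuous_const
    · exact continuous_const
  have hinv : ∀ y, Measurable fun q : V → ℝ => (groundedLaplacian G q k)⁻¹ x y := by
    intro y
    simp only [Matrix.inv_def, Matrix.smul_apply, Ring.inverse_eq_inv', smul_eq_mul]
    exact hA.matrix_det.measurable.inv.mul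
      (((continuous_apply y).comp ((continuous_apply x).comp hA.matrix_adjugate)).measurable)
  simp only [potential, Matrix.mulVec, dotProduct]
  exact Finset.measurable_sum _ fun y _ => (hinv y).mul measurable_const

end Network

/-! ### The scale function of a strong reinforcement -/

/-- A strong reinforcement function: positive, continuous and non-decreasing on the whole line,
with an inverse which is integrable near infinity. -/
structure IsStrongWeight (a : ℝ) (w : ℝ → ℝ) : Prop where
  continuous : Continuous w
  monotone : Monotone w
  pos : ∀ x, 0 < w x
  integrableOn : IntegrableOn (fun x => (w x)⁻¹) (Set.Ioi a)

/-- The primitive `x ↦ ∫_a^x 1/w`, in which local times are measured. -/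
def scale (w : ℝ → ℝ) (a x : ℝ) : ℝ := ∫ t in a..x, (w t)⁻¹

/-- The total mass `∫_a^∞ 1/w` of the scale. -/
def scaleTotal (w : ℝ → ℝ) (a : ℝ) : ℝ := ∫ t in Set.Ioi a, (w t)⁻¹

section Scale

variable {a : ℝ} {w : ℝ → ℝ} (hw : IsStrongWeight a w)
include hw

lemma IsStrongWeight.continuous_inv : Continuous fun x => (w x)⁻¹ :=
  hw.continuous.inv₀ fun x => (hw.pos x).ne'

lemma IsStrongWeight.inv_pos (x : ℝ) : 0 < (w x)⁻¹ := _root_.inv_pos.2 (hw.pos x)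

lemma hasDerivAt_scale (x : ℝ) : HasDerivAt (scale w a) (w x)⁻¹ x :=
  intervalIntegral.integral_hasDerivAt_right (hw.continuous_inv.intervalIntegrable _ _)
    (hw.continuous_inv.stronglyMeasurableAtFilter _ _) hw.continuous_inv.continuousAt

lemma continuous_scale : Continuous (scale w a) :=
  continuous_iff_continuousAt.2 fun x => (hasDerivAt_scale hw x).continuousAt

lemma scale_mono : Monotone (scale w a) :=
  monotone_of_deriv_nonneg (fun x => (hasDerivAt_scale hw x).differentiableAt) fun x => by
    rw [(hasDerivAt_scale hw x).deriv]; exact (hw.inv_pos x).le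

lemma tendsto_scale : Tendsto (scale w a) atTop (𝓝 (scaleTotal w a)) :=
  intervalIntegral_tendsto_integral_Ioi a hw.integrableOn tendsto_id

lemma scale_le_total (x : ℝ) : scale w a x ≤ scaleTotal w a :=
  (scale_mono hw).ge_of_tendsto (tendsto_scale hw) x

lemma scale_nonneg {x : ℝ} (hx : a ≤ x) : 0 ≤ scale w a x := by
  have := scale_mono hw hx
  simpa [scale] using this

lemma scale_sub_le {x y : ℝ} (hx : a ≤ x) : scale w a y - scale w a x ≤ scaleTotal w a := by
  linarith [scale_nonneg hw hx, scale_le_total hw y]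

lemma scale_sub_ge {x y : ℝ} (hxy : x ≤ y) : (y - x) / w y ≤ scale w a y - scale w a x := by
  have h1 : scale w a y - scale w a x = ∫ t in x..y, (w t)⁻¹ := by
    unfold scale
    rw [intervalIntegral.integral_interval_sub_left] <;>
      exact hw.continuous_inv.intervalIntegrable _ _
  rw [h1]
  have h2 : ∫ t in x..y, (w y)⁻¹ ≤ ∫ t in x..y, (w t)⁻¹ := by
    apply intervalIntegral.integral_mono_on hxy (by simp)
      (hw.continuous_inv.intervalIntegrable _ _)
    intro t ht
    exact inv_anti₀ (hw.pos t) (hw.monotone ht.2)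
  rw [intervalIntegral.integral_const, smul_eq_mul] at h2
  rwa [div_eq_mul_inv]

/-- During an exponential holding time at a vertex with local time at most `K`, the scale grows
in proportion to the bounded concave function `1 - exp (-s)` of the holding time `s`. -/
lemma one_sub_exp_div_le_scale_sub {x K s : ℝ} (hx : x ≤ K) (hs : 0 ≤ s) :
    (1 - Real.exp (-s)) / w (K + 1) ≤ scale w a (x + s) - scale w a x := by
  have hK := hw.pos (K + 1)
  have h0 : 1 - Real.exp (-s) ≤ s := by linarith [Real.add_one_le_exp (-s)]
  have h1 : 1 - Real.exp (-s) ≤ 1 := by linarith [Real.exp_pos (-s)]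
  have hmin : 1 - Real.exp (-s) ≤ min s 1 := le_min h0 h1
  have h2 := scale_sub_ge hw (x := x) (y := x + min s 1) (by linarith [le_min hs zero_le_one])
  have h3 : scale w a (x + min s 1) ≤ scale w a (x + s) :=
    scale_mono hw (by linarith [min_le_left s 1])
  have h4 : w (x + min s 1) ≤ w (K + 1) := hw.monotone (by linarith [min_le_right s 1])
  calc (1 - Real.exp (-s)) / w (K + 1) ≤ min s 1 / w (K + 1) := by gcongr
    _ ≤ min s 1 / w (x + min s 1) :=
        div_le_div_of_nonneg_left (le_min hs zero_le_one) (hw.pos _) h4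
    _ ≤ _ := by have e : x + min s 1 - x = min s 1 := by ring
                rw [e] at h2; linarith

end Scale

/-! ### One step of the jump chain -/

lemma integrableOn_exp_mul {W : ℝ} (hW : 0 < W) {g : ℝ → ℝ} (hg : Continuous g) {C : ℝ}
    (hC : ∀ s, 0 < s → |g s| ≤ C) :
    IntegrableOn (fun s => Real.exp (-(s * W)) * g s) (Set.Ioi 0) := by
  have h1 : IntegrableOn (fun s => Real.exp (-(s * W))) (Set.Ioi 0) := by
    refine (exp_neg_integrableOn_Ioi 0 hW).congr_fun (fun s _ => ?_) measurableSet_Ioi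
    simp only; congr 1; ring
  have h2 := Integrable.bdd_mul (c := C) h1 hg.aestronglyMeasurable
    (by
      filter_upwards [ae_restrict_mem measurableSet_Ioi] with s hs
      simpa [Real.norm_eq_abs] using hC s hs)
  refine Integrable.congr h2 (ae_of_all _ fun s => ?_)
  simp only; ring

/-- Second moment bound for one step, in integrated form.  The square of the increment and its
mean, integrated against the exponential density, are total derivatives up to the term `b * p`. -/
lemma lintegral_sq_step_le {W b S ε I p₀ : ℝ} (hW : 0 < W) (hb : 0 ≤ b)
    {P p K : ℝ → ℝ} (hP : ∀ s, HasDerivAt P (p s) s) (hp : Continuous p) (hP0 : P 0 = 0)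
    (hPI : ∀ s, 0 < s → |P s| ≤ I) (hP_nonneg : ∀ s, 0 < s → 0 ≤ P s)
    (hp0 : ∀ s, 0 < s → |p s| ≤ p₀)
    (hK : ∀ s, 0 < s → 0 ≤ K s)
    (hKle : ∀ s, 0 < s → K s ≤ Real.exp (-(s * W)) *
      (W * (S + ε * P s) ^ 2 - 2 * (S + ε * P s) * (ε * p s) + b * p s)) :
    ∫⁻ s in Set.Ioi (0 : ℝ), ENNReal.ofReal (K s)
      ≤ ∫⁻ s in Set.Ioi (0 : ℝ), ENNReal.ofReal (Real.exp (-(s * W)) * (W * S ^ 2 + b * W * P s)) := by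
  have hPc : Continuous P := continuous_iff_continuousAt.2 fun s => (hP s).continuousAt
  have hI : 0 ≤ I := (abs_nonneg _).trans (hPI 1 one_pos)
  have hp₀ : 0 ≤ p₀ := (abs_nonneg _).trans (hp0 1 one_pos)
  set q : ℝ → ℝ := fun s => b * P s - 2 * S * ε * P s - ε ^ 2 * P s ^ 2 with hq
  set q' : ℝ → ℝ := fun s => b * p s - 2 * S * ε * p s - ε ^ 2 * (2 * P s * p s) with hq'
  have hqd : ∀ s, HasDerivAt q (q' s) s := fun s => by
    have h := (((hP s).const_mul b).sub ((hP s).const_mul (2 * S * ε))).sub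
      (((hP s).pow 2).const_mul (ε ^ 2))
    refine h.congr_deriv ?_
    simp only [hq', Nat.cast_ofNat]; ring
  have hGd : ∀ s, HasDerivAt (fun s => Real.exp (-(s * W)) * q s)
      (Real.exp (-(s * W)) * (q' s - W * q s)) s := fun s => by
    have he : HasDerivAt (fun s => Real.exp (-(s * W))) (Real.exp (-(s * W)) * (-(1 * W))) s :=
      (((hasDerivAt_id s).mul_const W).neg).exp
    refine (he.mul (hqd s)).congr_deriv ?_
    ring
  have hqb : ∀ s, 0 < s → |q s| ≤ b * I + |2 * S * ε| * I + ε ^ 2 * I ^ 2 := by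
    intro s hs
    have h1 : |b * P s| ≤ b * I := by
      rw [abs_mul, abs_of_nonneg hb]; exact mul_le_mul_of_nonneg_left (hPI s hs) hb
    have h2 : |2 * S * ε * P s| ≤ |2 * S * ε| * I := by
      rw [abs_mul]; exact mul_le_mul_of_nonneg_left (hPI s hs) (abs_nonneg _)
    have h3 : |ε ^ 2 * P s ^ 2| ≤ ε ^ 2 * I ^ 2 := by
      rw [abs_mul, abs_of_nonneg (sq_nonneg ε), abs_pow]
      exact mul_le_mul_of_nonneg_left (pow_le_pow_left₀ (abs_nonneg _) (hPI s hs) 2) (sq_nonneg _)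
    calc |q s| ≤ |b * P s - 2 * S * ε * P s| + |ε ^ 2 * P s ^ 2| := abs_sub _ _
      _ ≤ |b * P s| + |2 * S * ε * P s| + |ε ^ 2 * P s ^ 2| := by gcongr; exact abs_sub _ _
      _ ≤ _ := by linarith
  have hq'b : ∀ s, 0 < s → |q' s| ≤ b * p₀ + |2 * S * ε| * p₀ + ε ^ 2 * (2 * I * p₀) := by
    intro s hs
    have h1 : |b * p s| ≤ b * p₀ := by
      rw [abs_mul, abs_of_nonneg hb]; exact mul_le_mul_of_nonneg_left (hp0 s hs) hb
    have h2 : |2 * S * ε * p s| ≤ |2 * S * ε| * p₀ := by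
      rw [abs_mul]; exact mul_le_mul_of_nonneg_left (hp0 s hs) (abs_nonneg _)
    have h3 : |ε ^ 2 * (2 * P s * p s)| ≤ ε ^ 2 * (2 * I * p₀) := by
      rw [abs_mul, abs_of_nonneg (sq_nonneg ε), abs_mul, abs_mul, abs_of_pos two_pos]
      have := hPI s hs
      have := hp0 s hs
      gcongr
    calc |q' s| ≤ |b * p s - 2 * S * ε * p s| + |ε ^ 2 * (2 * P s * p s)| := abs_sub _ _
      _ ≤ |b * p s| + |2 * S * ε * p s| + |ε ^ 2 * (2 * P s * p s)| := by
          gcongr; exact abs_sub _ _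
      _ ≤ _ := by linarith
  have hqc : Continuous q := by fun_prop
  have hq'c : Continuous q' := by fun_prop
  have hG'i : IntegrableOn (fun s => Real.exp (-(s * W)) * (q' s - W * q s)) (Set.Ioi 0) := by
    refine integrableOn_exp_mul hW (by fun_prop)
      (C := (b * p₀ + |2 * S * ε| * p₀ + ε ^ 2 * (2 * I * p₀))
        + W * (b * I + |2 * S * ε| * I + ε ^ 2 * I ^ 2)) fun s hs => ?_
    refine (abs_sub _ _).trans ?_
    rw [abs_mul, abs_of_pos hW]
    exact add_le_add (hq'b s hs) (mul_le_mul_of_nonneg_left (hqb s hs) hW.le)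
  have hK2i : IntegrableOn (fun s => Real.exp (-(s * W)) * (W * S ^ 2 + b * W * P s))
      (Set.Ioi 0) := by
    refine integrableOn_exp_mul hW (by fun_prop) (C := W * S ^ 2 + b * W * I) fun s hs => ?_
    have h1 := hPI s hs
    rw [abs_of_nonneg (add_nonneg (by positivity)
      (mul_nonneg (by positivity) (hP_nonneg s hs)))]
    have := (le_abs_self (P s)).trans h1
    gcongr
  have hexp : Tendsto (fun s : ℝ => Real.exp (-(s * W))) atTop (𝓝 0) :=
    Real.tendsto_exp_neg_atTop_nhds_zero.comp (tendsto_id.atTop_mul_const hW)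
  have hlim : Tendsto (fun s => Real.exp (-(s * W)) * q s) atTop (𝓝 0) := by
    refine squeeze_zero_norm' (a := fun s => Real.exp (-(s * W))
      * (b * I + |2 * S * ε| * I + ε ^ 2 * I ^ 2)) ?_ (by simpa using hexp.mul_const _)
    filter_upwards [eventually_gt_atTop 0] with s hs
    rw [norm_mul, Real.norm_eq_abs, Real.norm_eq_abs, abs_of_pos (Real.exp_pos _)]
    exact mul_le_mul_of_nonneg_left (hqb s hs) (Real.exp_pos _).le
  have hint := integral_Ioi_of_hasDerivAt_of_tendsto (a := 0)
    (hGd 0).continuousAt.continuousWithinAt (fun s _ => hGd s) hG'i hlim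
  have hq0 : q 0 = 0 := by simp [hq, hP0]
  rw [hq0, mul_zero, sub_zero] at hint
  have hsum : ∀ s, Real.exp (-(s * W)) *
      (W * (S + ε * P s) ^ 2 - 2 * (S + ε * P s) * (ε * p s) + b * p s)
      = Real.exp (-(s * W)) * (W * S ^ 2 + b * W * P s)
        + Real.exp (-(s * W)) * (q' s - W * q s) := fun s => by
    simp only [hq, hq']; ring
  calc ∫⁻ s in Set.Ioi (0 : ℝ), ENNReal.ofReal (K s)
      ≤ ∫⁻ s in Set.Ioi (0 : ℝ), ENNReal.ofReal (Real.exp (-(s * W)) * (W * S ^ 2 + b * W * P s)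
        + Real.exp (-(s * W)) * (q' s - W * q s)) :=
        setLIntegral_mono' measurableSet_Ioi fun s hs =>
          ENNReal.ofReal_le_ofReal ((hKle s hs).trans (hsum s).le)
    _ = ENNReal.ofReal (∫ s in Set.Ioi (0 : ℝ), (Real.exp (-(s * W)) * (W * S ^ 2 + b * W * P s)
        + Real.exp (-(s * W)) * (q' s - W * q s))) := by
        refine (ofReal_integral_eq_lintegral_ofReal (hK2i.add hG'i) ?_).symm
        filter_upwards [ae_restrict_mem measurableSet_Ioi] with s hs
        exact ((hK s hs).trans (hKle s hs)).trans (hsum s).le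
    _ = ENNReal.ofReal (∫ s in Set.Ioi (0 : ℝ),
        Real.exp (-(s * W)) * (W * S ^ 2 + b * W * P s)) := by
        rw [integral_add hK2i hG'i, hint, add_zero]
    _ = _ := by
        refine ofReal_integral_eq_lintegral_ofReal hK2i ?_
        filter_upwards [ae_restrict_mem measurableSet_Ioi] with s hs
        exact mul_nonneg (Real.exp_pos _).le (add_nonneg (by positivity)
          (mul_nonneg (by positivity) (hP_nonneg s hs)))

section Step

variable {V : Type*} (G : SimpleGraph V) (w : ℝ → ℝ)

/-- The rate of the jump from `v` to `u` when the local times are `L`. -/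
def rate (L : V → ℝ) (v u : V) : ℝ := if G.Adj v u then w (L u) else 0

variable {G w} in
lemma rate_nonneg {a : ℝ} (hw : IsStrongWeight a w) (L : V → ℝ) (v u : V) : 0 ≤ rate G w L v u := by
  unfold rate; split_ifs
  · exact (hw.pos _).le
  · exact le_rfl

variable [Fintype V]

/-- The total jump rate from `v` when the local times are `L`. -/
def totalRate (L : V → ℝ) (v : V) : ℝ := ∑ u, rate G w L v u

/-- The mean of `φ s u`, where `s` is the holding time at `v`, and `u` the next position, for
the process at `v` with local times `L`. -/
def stepMean (L : V → ℝ) (v : V) (φ : ℝ → V → ENNReal) : ENNReal :=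
  ∑ u, ∫⁻ s in Set.Ioi (0 : ℝ),
    ENNReal.ofReal (rate G w L v u * Real.exp (-(s * totalRate G w L v))) * φ s u

/-- The martingale increment attached to the vertices `i` and `k`: over a holding time `s` at `v`
followed by a jump to `u`, it is the increment of the difference of the scaled local times at
`i` and `k`, plus the difference of the potentials at `u` and `v`, taken at the end of the step. -/
def stepIncr (a : ℝ) (i k : V) (L : V → ℝ) (v : V) (s : ℝ) (u : V) : ℝ :=
  ((if v = i then 1 else 0) - (if v = k then 1 else 0)) * (scale w a (L v + s) - scale w a (L v))
    + (potential G (w ∘ Function.update L v (L v + s)) i k u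
      - potential G (w ∘ Function.update L v (L v + s)) i k v)

variable {G w} {a : ℝ} (hw : IsStrongWeight a w)
include hw

lemma le_totalRate [Nontrivial V] (hG : G.Connected) {L : V → ℝ} (hL : ∀ v, a ≤ L v) (v : V) :
    w a ≤ totalRate G w L v := by
  obtain ⟨u, hu⟩ := hG.preconnected.exists_adj_of_nontrivial v
  calc w a ≤ w (L u) := hw.monotone (hL u)
    _ = rate G w L v u := by simp [rate, hu]
    _ ≤ _ := Finset.single_le_sum (f := fun u => rate G w L v u)
      (fun u _ => rate_nonneg hw L v u) (Finset.mem_univ u)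

lemma stepMean_const (L : V → ℝ) (v : V) {φ : ℝ → ENNReal} (hφ : Measurable φ) :
    stepMean G w L v (fun s _ => φ s) = ∫⁻ s in Set.Ioi (0 : ℝ),
      ENNReal.ofReal (totalRate G w L v * Real.exp (-(s * totalRate G w L v))) * φ s := by
  unfold stepMean
  rw [← lintegral_finsetSum _ fun u _ => by fun_prop]
  refine lintegral_congr fun s => ?_
  rw [← Finset.sum_mul, ← ENNReal.ofReal_sum_of_nonneg fun u _ =>
    mul_nonneg (rate_nonneg hw L v u) (Real.exp_pos _).le, ← Finset.sum_mul]
  rfl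

/-- The second moment of `S` plus the martingale increment exceeds `S ^ 2` by at most the mean
increment of the scaled local time, divided by the conductance of the edge `ik`. -/
lemma stepMean_sq_le [Nontrivial V] (hG : G.Connected) {L : V → ℝ} (hL : ∀ v, a ≤ L v) {i k : V}
    (hik : G.Adj i k) (v : V) (S : ℝ) :
    stepMean G w L v (fun s u => ENNReal.ofReal ((S + stepIncr G w a i k L v s u) ^ 2))
      ≤ stepMean G w L v (fun s _ => ENNReal.ofReal (S ^ 2
        + (w (L i) * w (L k))⁻¹ * (scale w a (L v + s) - scale w a (L v)))) := by
  set W := totalRate G w L v with hWdef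
  have hW : 0 < W := (hw.pos a).trans_le (le_totalRate hw hG hL v)
  set ε : ℝ := (if v = i then 1 else 0) - (if v = k then 1 else 0) with hε
  set P : ℝ → ℝ := fun s => scale w a (L v + s) - scale w a (L v) with hPdef
  set b : ℝ := (w (L i) * w (L k))⁻¹ with hb
  have hPd : ∀ s, HasDerivAt P (w (L v + s))⁻¹ s := fun s => by
    have h := (hasDerivAt_scale hw (L v + s)).comp_const_add (L v) s
    exact h.sub_const _
  have hPc : Continuous P := continuous_iff_continuousAt.2 fun s => (hPd s).continuousAt
  have hPnn : ∀ s, 0 < s → 0 ≤ P s := fun s hs => sub_nonneg.2 (scale_mono hw (by linarith))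
  have hmeas : ∀ u, Measurable fun s => stepIncr G w a i k L v s u := by
    intro u
    have h1 : Measurable fun s => w ∘ Function.update L v (L v + s) := by
      refine measurable_pi_lambda _ fun x => hw.continuous.measurable.comp ?_
      by_cases hx : x = v
      · subst hx; simp only [Function.update_self]; fun_prop
      · simp only [Function.update_of_ne hx]; fun_prop
    have h2 := continuous_scale hw
    unfold stepIncr
    refine Measurable.add ?_ (((measurable_potential i k u).comp h1).sub
      ((measurable_potential i k v).comp h1))
    exact (Continuous.measurable (by fun_prop))
  have hsc := continuous_scale hw
  rw [stepMean_const hw L v (by fun_prop)]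
  unfold stepMean
  rw [← lintegral_finsetSum _ fun u _ => by
    have := hmeas u
    fun_prop]
  have hLHS : ∀ s, ∑ u, ENNReal.ofReal (rate G w L v u * Real.exp (-(s * W)))
      * ENNReal.ofReal ((S + stepIncr G w a i k L v s u) ^ 2)
      = ENNReal.ofReal (∑ u, rate G w L v u * Real.exp (-(s * W))
        * (S + stepIncr G w a i k L v s u) ^ 2) := by
    intro s
    rw [ENNReal.ofReal_sum_of_nonneg fun u _ => mul_nonneg
      (mul_nonneg (rate_nonneg hw L v u) (Real.exp_pos _).le) (sq_nonneg _)]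
    exact Finset.sum_congr rfl fun u _ => (ENNReal.ofReal_mul
      (mul_nonneg (rate_nonneg hw L v u) (Real.exp_pos _).le)).symm
  have hRHS : ∀ s, ENNReal.ofReal (W * Real.exp (-(s * W)))
      * ENNReal.ofReal (S ^ 2 + b * P s)
      = ENNReal.ofReal (Real.exp (-(s * W)) * (W * S ^ 2 + b * W * P s)) := by
    intro s
    rw [← ENNReal.ofReal_mul (mul_nonneg hW.le (Real.exp_pos _).le)]
    congr 1; ring
  refine (lintegral_congr hLHS).trans_le (le_of_le_of_eq ?_ (lintegral_congr hRHS).symm)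
  have hbnn : 0 ≤ b := inv_nonneg.2 (mul_pos (hw.pos _) (hw.pos _)).le
  refine lintegral_sq_step_le (p := fun s => (w (L v + s))⁻¹) (ε := ε) (I := scaleTotal w a)
    (p₀ := (w a)⁻¹) hW hbnn hPd ?_ (by simp [hPdef]) (fun s hs => ?_) hPnn (fun s hs => ?_)
    (fun s hs => ?_) (fun s hs => ?_)
  · exact hw.continuous_inv.comp (continuous_const.add continuous_id)
  · rw [abs_of_nonneg (hPnn s hs)]; exact scale_sub_le hw (hL v)
  · rw [abs_of_pos (hw.inv_pos _)]
    exact inv_anti₀ (hw.pos a) (hw.monotone (by linarith [hL v]))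
  · exact Finset.sum_nonneg fun u _ => mul_nonneg
      (mul_nonneg (rate_nonneg hw L v u) (Real.exp_pos _).le) (sq_nonneg _)
  · set q : V → ℝ := w ∘ Function.update L v (L v + s) with hq
    have hqpos : ∀ x, 0 < q x := fun x => hw.pos _
    set f := potential G q i k with hf
    have hqv : q v = w (L v + s) := by simp [hq]
    have hpv : 0 < w (L v + s) := hw.pos _
    have hcond : ∀ u, cond G q v u = w (L v + s) * rate G w L v u := by
      intro u
      unfold cond rate
      split_ifs with h
      · rw [hqv]; simp [hq, Function.update_of_ne h.ne']
      · simp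
    have h1 : ∑ u, rate G w L v u * (f v - f u) = ε * (w (L v + s))⁻¹ := by
      have h := current_potential hG hqpos i k v
      rw [← hf, ← hε] at h
      simp only [current, hcond, mul_assoc, ← Finset.mul_sum] at h
      rw [← h]; field_simp
    have hbq : (q i * q k)⁻¹ ≤ b := by
      have hmono : ∀ x, w (L x) ≤ q x := fun x => by
        by_cases hx : x = v
        · rw [hx, hqv]; exact hw.monotone (by linarith)
        · simp [hq, Function.update_of_ne hx]
      exact inv_anti₀ (mul_pos (hw.pos _) (hw.pos _))
        (mul_le_mul (hmono i) (hmono k) (hw.pos _).le (hqpos i).le)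
    have h2 : ∑ u, rate G w L v u * (f v - f u) ^ 2 ≤ b * (w (L v + s))⁻¹ := by
      have h := (star_energy_potential_le hG hqpos hik v).trans hbq
      rw [← hf] at h
      simp only [hcond, mul_assoc, ← Finset.mul_sum] at h
      rw [← div_eq_mul_inv, le_div_iff₀ hpv]
      linarith
    have h3 : ∑ u, rate G w L v u * Real.exp (-(s * W)) * (S + stepIncr G w a i k L v s u) ^ 2
        = Real.exp (-(s * W)) * (W * (S + ε * P s) ^ 2
          - 2 * (S + ε * P s) * ∑ u, rate G w L v u * (f v - f u)
          + ∑ u, rate G w L v u * (f v - f u) ^ 2) := by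
      have hWs : W * (S + ε * P s) ^ 2 = ∑ u, rate G w L v u * (S + ε * P s) ^ 2 := by
        rw [← Finset.sum_mul]; rfl
      rw [hWs, Finset.mul_sum, ← Finset.sum_sub_distrib, ← Finset.sum_add_distrib, Finset.mul_sum]
      refine Finset.sum_congr rfl fun u _ => ?_
      simp only [stepIncr, ← hq, ← hf, ← hε, hPdef]
      ring
    rw [h3, h1]
    have := h2
    gcongr

/-- The probability of a jump from `x` to `y` is at most a constant times the mean increment of
the scaled local time at `x`, as long as the local times at `x` and `y` are bounded. -/
lemma stepMean_jump_le [Nontrivial V] (hG : G.Connected) {L : V → ℝ} (hL : ∀ v, a ≤ L v) {x y : V}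
    {K : ℝ} (hx : L x ≤ K) (hy : L y ≤ K) :
    stepMean G w L x (fun _ u => if u = y then 1 else 0)
      ≤ stepMean G w L x (fun s _ => ENNReal.ofReal (w K * w (K + 1) * (1 + (w a)⁻¹) *
        (scale w a (L x + s) - scale w a (L x)))) := by
  set W := totalRate G w L x with hWdef
  have hWa : w a ≤ W := le_totalRate hw hG hL x
  have ha := hw.pos a
  have hW : 0 < W := ha.trans_le hWa
  have hK := hw.pos K
  have hK1 := hw.pos (K + 1)
  have hsc := continuous_scale hw
  rw [stepMean_const hw L x (by fun_prop)]
  have hr : rate G w L x y ≤ w K := by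
    unfold rate; split_ifs
    · exact hw.monotone hy
    · exact hK.le
  have hexp : ∀ {c : ℝ}, 0 < c → IntegrableOn (fun s => Real.exp (-(s * c))) (Set.Ioi 0) ∧
      ∫ s in Set.Ioi (0 : ℝ), Real.exp (-(s * c)) = 1 / c := by
    intro c hc
    have e : (fun s : ℝ => Real.exp (-(s * c))) = fun s => Real.exp (-c * s) := by
      funext s; congr 1; ring
    rw [e]
    refine ⟨exp_neg_integrableOn_Ioi 0 hc, ?_⟩
    rw [integral_exp_mul_Ioi (by linarith) 0]
    simp [neg_div_neg_eq]
  obtain ⟨i1, e1⟩ := hexp hW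
  obtain ⟨i2, e2⟩ := hexp (c := W + 1) (by linarith)
  have hlhs : stepMean G w L x (fun _ u => if u = y then 1 else 0)
      ≤ ENNReal.ofReal (w K * (1 / W)) := by
    unfold stepMean
    rw [Finset.sum_eq_single y (fun u _ hu => by simp [hu]) (by simp)]
    simp only [if_true, mul_one]
    rw [← e1, ← integral_const_mul, ofReal_integral_eq_lintegral_ofReal (i1.const_mul _)
      (ae_of_all _ fun s => mul_nonneg hK.le (Real.exp_pos _).le)]
    refine lintegral_mono fun s => ENNReal.ofReal_le_ofReal ?_
    exact mul_le_mul_of_nonneg_right hr (Real.exp_pos _).le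
  refine hlhs.trans ?_
  have hrhs : w K * (1 / W) ≤ ∫ s in Set.Ioi (0 : ℝ), w K * (1 + (w a)⁻¹) * W *
      (Real.exp (-(s * W)) - Real.exp (-(s * (W + 1)))) := by
    rw [integral_const_mul, integral_sub i1 i2, e1, e2]
    have e3 : w K * (1 + (w a)⁻¹) * W * (1 / W - 1 / (W + 1))
        = w K * ((w a + 1) / (w a * (W + 1))) := by field_simp; ring
    rw [e3]
    refine mul_le_mul_of_nonneg_left ?_ hK.le
    rw [div_le_div_iff₀ hW (by positivity)]
    nlinarith
  refine (ENNReal.ofReal_le_ofReal hrhs).trans ?_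
  have hnn : ∀ s, 0 < s → 0 ≤ Real.exp (-(s * W)) - Real.exp (-(s * (W + 1))) := fun s hs =>
    sub_nonneg.2 (Real.exp_le_exp.2 (by nlinarith))
  refine (ofReal_integral_eq_lintegral_ofReal ((i1.sub i2).const_mul _) (by
    filter_upwards [ae_restrict_mem measurableSet_Ioi] with s hs
    exact mul_nonneg (by positivity) (hnn s hs))).trans_le ?_
  refine setLIntegral_mono' measurableSet_Ioi fun s hs => ?_
  rw [← ENNReal.ofReal_mul (by positivity)]
  refine ENNReal.ofReal_le_ofReal ?_
  have h1 := one_sub_exp_div_le_scale_sub hw hx (le_of_lt hs)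
  rw [div_le_iff₀ hK1] at h1
  have h2 : Real.exp (-(s * W)) - Real.exp (-(s * (W + 1)))
      = Real.exp (-(s * W)) * (1 - Real.exp (-s)) := by
    rw [mul_sub, mul_one, ← Real.exp_add]; congr 2; ring
  have h3 : 0 ≤ w K * (1 + (w a)⁻¹) * W * Real.exp (-(s * W)) := by positivity
  calc w K * (1 + (w a)⁻¹) * W * (Real.exp (-(s * W)) - Real.exp (-(s * (W + 1))))
      = w K * (1 + (w a)⁻¹) * W * Real.exp (-(s * W)) * (1 - Real.exp (-s)) := by rw [h2]; ring
    _ ≤ _ := mul_le_mul_of_nonneg_left h1 h3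
    _ = _ := by ring

end Step

/-! ### The jump chain and its one-step disintegration -/

section Chain

variable {Ω V : Type*}

/-- The `n`-th holding time `τ_{n+1} - τ_n`.  The subtraction is truncated, so that it is
nonnegative everywhere. -/
def hold (τ : ℕ → Ω → ℝ≥0) (n : ℕ) (ω : Ω) : ℝ := ((τ (n + 1) ω - τ n ω : ℝ≥0) : ℝ)

/-- The local time at the vertex `v` after `n` jumps. -/
def chainTime (ℓ : V → ℝ) (τ : ℕ → Ω → ℝ≥0) (Y : ℕ → Ω → V) (n : ℕ) (ω : Ω) (v : V) : ℝ :=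
  ℓ v + ∑ m ∈ Finset.range n, if Y m ω = v then hold τ m ω else 0

/-- The jump chain `(Y_n)` with jump times `(τ_n)` has the law prescribed by the rates: given the
history up to the `n`-th jump, the holding time is exponential with parameter the total rate, and
the next vertex is independent of it and chosen proportionally to the rates. -/
structure IsJumpChain [Fintype V] [MeasurableSpace Ω] (G : SimpleGraph V) (w : ℝ → ℝ) (ℓ : V → ℝ)
    (μ : Measure Ω) (τ : ℕ → Ω → ℝ≥0) (Y : ℕ → Ω → V) : Prop where
  measurable_time : ∀ n, Measurable (τ n)
  measurable_vertex : ∀ n, Measurable[_, ⊤] (Y n)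
  time_lt : ∀ᵐ ω ∂μ, ∀ n, τ n ω < τ (n + 1) ω
  jump_law : ∀ (n : ℕ) (H : Set Ω), MeasurableSet[history τ Y n] H → ∀ (v : V) (s : ℝ≥0),
    μ (H ∩ {ω | τ n ω + s < τ (n + 1) ω ∧ Y (n + 1) ω = v})
      = ∫⁻ ω in H, ENNReal.ofReal (rate G w (chainTime ℓ τ Y n ω) (Y n ω) v
          / totalRate G w (chainTime ℓ τ Y n ω) (Y n ω)
          * Real.exp (-(s * totalRate G w (chainTime ℓ τ Y n ω) (Y n ω)))) ∂μ

variable {τ : ℕ → Ω → ℝ≥0} {Y : ℕ → Ω → V} {ℓ : V → ℝ}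

lemma hold_nonneg (n : ℕ) (ω : Ω) : 0 ≤ hold τ n ω := NNReal.coe_nonneg _

lemma chainTime_succ (n : ℕ) (ω : Ω) : chainTime ℓ τ Y (n + 1) ω
    = Function.update (chainTime ℓ τ Y n ω) (Y n ω)
      (chainTime ℓ τ Y n ω (Y n ω) + hold τ n ω) := by
  funext v
  by_cases h : v = Y n ω
  · subst h
    rw [Function.update_self]
    simp only [chainTime, Finset.sum_range_succ, if_true]
    ring
  · rw [Function.update_of_ne h]
    simp [chainTime, Finset.sum_range_succ, Ne.symm h]

lemma chainTime_mono (ω : Ω) (v : V) : Monotone fun n => chainTime ℓ τ Y n ω v := by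
  refine monotone_nat_of_le_succ fun n => ?_
  simp only [chainTime, Finset.sum_range_succ]
  have := hold_nonneg (τ := τ) n ω
  split_ifs <;> linarith

lemma le_chainTime {a : ℝ} (hℓ : ∀ v, a ≤ ℓ v) (n : ℕ) (ω : Ω) (v : V) :
    a ≤ chainTime ℓ τ Y n ω v := by
  have h := chainTime_mono (ℓ := ℓ) (τ := τ) (Y := Y) ω v (Nat.zero_le n)
  simp only [chainTime, Finset.range_zero, Finset.sum_empty, add_zero] at h
  exact (hℓ v).trans h

lemma history_mono : Monotone (history τ Y) := fun _ _ hmn =>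
  biSup_mono fun _ hk => le_trans (Set.mem_Iic.1 hk) hmn

lemma measurable_history_time {m n : ℕ} (h : m ≤ n) : Measurable[history τ Y n] (τ m) := by
  rw [measurable_iff_comap_le]
  exact le_sup_left.trans (le_biSup
    (fun k => MeasurableSpace.comap (τ k) inferInstance ⊔ MeasurableSpace.comap (Y k) ⊤)
    (Set.mem_Iic.2 h))

lemma measurable_history_vertex {m n : ℕ} (h : m ≤ n) : Measurable[history τ Y n, ⊤] (Y m) := by
  rw [measurable_iff_comap_le]
  exact le_sup_right.trans (le_biSup
    (fun k => MeasurableSpace.comap (τ k) inferInstance ⊔ MeasurableSpace.comap (Y k) ⊤)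
    (Set.mem_Iic.2 h))

lemma measurableSet_history_eq {m n : ℕ} (h : m ≤ n) (v : V) :
    MeasurableSet[history τ Y n] {ω | Y m ω = v} :=
  measurable_history_vertex h (t := {v}) trivial

lemma measurable_hold' {mΩ : MeasurableSpace Ω} {n : ℕ} (h0 : Measurable (τ n))
    (h1 : Measurable (τ (n + 1))) : Measurable (hold τ n) :=
  (h1.sub h0).coe_nnreal_real

lemma measurable_chainTime' {mΩ : MeasurableSpace Ω} {n : ℕ} (hτ : ∀ m ≤ n, Measurable (τ m))
    (hY : ∀ m ≤ n, ∀ v, MeasurableSet {ω | Y m ω = v}) : Measurable (chainTime ℓ τ Y n) := by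
  refine measurable_pi_lambda _ fun v => measurable_const.add ?_
  refine Finset.measurable_sum _ fun m hm => ?_
  have hm' := Finset.mem_range.1 hm
  exact Measurable.ite (hY m hm'.le v) (measurable_hold' (hτ m hm'.le) (hτ (m + 1) hm'))
    measurable_const

lemma measurable_chainTime {m n : ℕ} (h : m ≤ n) :
    Measurable[history τ Y n] (chainTime ℓ τ Y m) :=
  @measurable_chainTime' Ω V τ Y ℓ (history τ Y n) m
    (fun _ hk => measurable_history_time (hk.trans h))
    (fun _ hk v => measurableSet_history_eq (hk.trans h) v)

section

variable [MeasurableSpace Ω]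

lemma history_le (hτ : ∀ n, Measurable (τ n)) (hY : ∀ n, Measurable[_, ⊤] (Y n)) (n : ℕ) :
    history τ Y n ≤ (inferInstance : MeasurableSpace Ω) :=
  iSup₂_le fun k _ => sup_le (hτ k).comap_le (hY k).comap_le

/-- Splitting an integral according to the value of a random vertex. -/
lemma lintegral_eq_sum_vertex [Fintype V] {μ : Measure Ω} {Z : Ω → V} (hZ : Measurable[_, ⊤] Z)
    (f : V → Ω → ENNReal) :
    ∫⁻ ω, f (Z ω) ω ∂μ = ∑ v, ∫⁻ ω in {ω | Z ω = v}, f v ω ∂μ := by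
  have hmeas : ∀ v, MeasurableSet {ω | Z ω = v} := fun v => hZ (t := {v}) trivial
  have h1 : ∫⁻ ω, f (Z ω) ω ∂μ = ∫⁻ ω in ⋃ v ∈ (Finset.univ : Finset V), {ω | Z ω = v},
      f (Z ω) ω ∂μ := by
    have : ⋃ v ∈ (Finset.univ : Finset V), {ω | Z ω = v} = Set.univ := by
      ext ω; simp
    rw [this, setLIntegral_univ]
  rw [h1, lintegral_biUnion_finset _ fun v _ => hmeas v]
  · refine Finset.sum_congr rfl fun v _ => setLIntegral_congr_fun (hmeas v) fun ω hω => ?_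
    have : Z ω = v := hω
    simp only [this]
  · intro v _ v' _ hvv'
    refine Set.disjoint_left.2 fun ω h h' => hvv' ?_
    have e1 : Z ω = v := h
    have e2 : Z ω = v' := h'
    exact e1.symm.trans e2

end

variable {G : SimpleGraph V} {w : ℝ → ℝ} {a : ℝ}

lemma measurable_rate (hw : IsStrongWeight a w) (v u : V) :
    Measurable fun L : V → ℝ => rate G w L v u := by
  unfold rate
  split_ifs
  · exact hw.continuous.measurable.comp (measurable_pi_apply u)
  · exact measurable_const

lemma measurable_totalRate [Fintype V] (hw : IsStrongWeight a w) (v : V) :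
    Measurable fun L : V → ℝ => totalRate G w L v :=
  Finset.measurable_sum _ fun u _ => measurable_rate hw v u

lemma lintegral_exp_tail {r W : ℝ} (hr : 0 ≤ r) (hW : 0 < W) (s : ℝ≥0) :
    ∫⁻ t in Set.Ioi (s : ℝ), ENNReal.ofReal (r * Real.exp (-(t * W)))
      = ENNReal.ofReal (r / W * Real.exp (-(s * W))) := by
  have e : (fun t : ℝ => Real.exp (-(t * W))) = fun t => Real.exp (-W * t) := by
    funext t; congr 1; ring
  have hi : IntegrableOn (fun t : ℝ => Real.exp (-(t * W))) (Set.Ioi (s : ℝ)) := by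
    rw [e]; exact exp_neg_integrableOn_Ioi _ hW
  have h := ofReal_integral_eq_lintegral_ofReal (hi.const_mul r)
    (ae_of_all _ fun t => mul_nonneg hr (Real.exp_pos _).le)
  refine h.symm.trans ?_
  rw [integral_const_mul, e, integral_exp_mul_Ioi (by linarith)]
  congr 1
  rw [neg_div_neg_eq, show -W * (s : ℝ) = -(s * W) by ring]
  ring

variable [Fintype V] [MeasurableSpace Ω] {μ : Measure Ω}

/-- On the event that the `n`-th jump goes from `v` to `u`, the joint law of a history-measurable
`g` and of the holding time has the density prescribed by the rates. -/
lemma map_hold_eq [IsProbabilityMeasure μ] [Nontrivial V] (hG : G.Connected)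
    (hw : IsStrongWeight a w)
    (hℓ : ∀ v, a ≤ ℓ v) (hJ : IsJumpChain G w ℓ μ τ Y) {E : Type*} [MeasurableSpace E] (n : ℕ)
    {g : Ω → E} (hg : Measurable[history τ Y n] g) {β : E → V → ℝ} (hβ : Measurable β)
    (hgβ : ∀ ω, β (g ω) = chainTime ℓ τ Y n ω) (v u : V) :
    (μ.restrict ({ω | Y n ω = v} ∩ {ω | Y (n + 1) ω = u})).map (fun ω => (g ω, hold τ n ω))
      = (((μ.restrict {ω | Y n ω = v}).map g).prod (volume.restrict (Set.Ioi (0 : ℝ)))).withDensity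
        (fun p => ENNReal.ofReal (rate G w (β p.1) v u
          * Real.exp (-(p.2 * totalRate G w (β p.1) v)))) := by
  have hle := history_le hJ.measurable_time hJ.measurable_vertex n
  have hg' : Measurable g := hg.mono hle le_rfl
  have hhold : Measurable (hold τ n) :=
    measurable_hold' (hJ.measurable_time n) (hJ.measurable_time (n + 1))
  have hpair : Measurable fun ω => (g ω, hold τ n ω) := hg'.prodMk hhold
  have hYn : MeasurableSet {ω | Y n ω = v} := hJ.measurable_vertex n (t := {v}) trivial
  have hYn1 : MeasurableSet {ω | Y (n + 1) ω = u} :=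
    hJ.measurable_vertex (n + 1) (t := {u}) trivial
  have hrm := measurable_rate (G := G) hw v u
  have htm := measurable_totalRate (G := G) hw v
  have hdens : Measurable fun p : E × ℝ => ENNReal.ofReal (rate G w (β p.1) v u
      * Real.exp (-(p.2 * totalRate G w (β p.1) v))) := by
    have h1 : Measurable fun p : E × ℝ => rate G w (β p.1) v u :=
      hrm.comp (hβ.comp measurable_fst)
    have h2 : Measurable fun p : E × ℝ => totalRate G w (β p.1) v :=
      htm.comp (hβ.comp measurable_fst)
    fun_prop
  have hpos : ∀ ω, 0 < totalRate G w (chainTime ℓ τ Y n ω) v := fun ω =>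
    (hw.pos a).trans_le (le_totalRate hw hG (le_chainTime hℓ n ω) v)
  have key : ∀ (B : Set E), MeasurableSet B → ∀ s : ℝ≥0,
      (μ.restrict ({ω | Y n ω = v} ∩ {ω | Y (n + 1) ω = u})).map (fun ω => (g ω, hold τ n ω))
        (B ×ˢ Set.Ioi (s : ℝ))
      = (((μ.restrict {ω | Y n ω = v}).map g).prod (volume.restrict (Set.Ioi (0 : ℝ)))).withDensity
        (fun p => ENNReal.ofReal (rate G w (β p.1) v u
          * Real.exp (-(p.2 * totalRate G w (β p.1) v)))) (B ×ˢ Set.Ioi (s : ℝ)) := by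
    intro B hB s
    have hBs : MeasurableSet (B ×ˢ Set.Ioi (s : ℝ)) := hB.prod measurableSet_Ioi
    have hL : (μ.restrict ({ω | Y n ω = v} ∩ {ω | Y (n + 1) ω = u})).map
        (fun ω => (g ω, hold τ n ω)) (B ×ˢ Set.Ioi (s : ℝ))
        = μ ((g ⁻¹' B ∩ {ω | Y n ω = v}) ∩ {ω | τ n ω + s < τ (n + 1) ω ∧ Y (n + 1) ω = u}) := by
      rw [Measure.map_apply hpair hBs, Measure.restrict_apply (hpair hBs)]
      congr 1
      ext ω
      have : (s : ℝ) < hold τ n ω ↔ τ n ω + s < τ (n + 1) ω := by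
        rw [hold, NNReal.coe_lt_coe, lt_tsub_iff_left]
      simp only [Set.mem_inter_iff, Set.mem_preimage, Set.mem_prod, Set.mem_Ioi, Set.mem_ofPred_eq,
        this]
      tauto
    rw [hL, hJ.jump_law n _ ((hg hB).inter (measurableSet_history_eq le_rfl v)) u s,
      withDensity_apply _ hBs, ← Measure.prod_restrict, lintegral_prod _ hdens.aemeasurable,
      setLIntegral_map hB hdens.lintegral_prod_right' hg', Measure.restrict_restrict (hg' hB)]
    refine setLIntegral_congr_fun ((hg' hB).inter hYn) fun ω hω => ?_
    have hv : Y n ω = v := hω.2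
    rw [Measure.restrict_restrict measurableSet_Ioi,
      Set.inter_eq_left.2 (Set.Ioi_subset_Ioi s.coe_nonneg)]
    simp only [hgβ, hv]
    exact (lintegral_exp_tail (rate_nonneg hw _ v u) (hpos ω) s).symm
  refine Measure.ext_of_generateFrom_of_iUnion
    (Set.image2 (· ×ˢ ·) {B : Set E | MeasurableSet B} (Set.range Set.Ioi))
    (fun m : ℕ => Set.univ ×ˢ Set.Ioi (-(m : ℝ))) ?_ ?_ ?_ ?_ ?_ ?_
  · refine (generateFrom_eq_prod MeasurableSpace.generateFrom_measurableSet
      ((borel_eq_generateFrom_Ioi ℝ).symm.trans BorelSpace.measurable_eq.symm)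
      isCountablySpanning_measurableSet
      ⟨fun m : ℕ => Set.Ioi (-(m : ℝ)), fun m => Set.mem_range_self _, ?_⟩).symm
    refine Set.eq_univ_of_forall fun x => ?_
    obtain ⟨m, hm⟩ := exists_nat_gt (-x)
    exact Set.mem_iUnion.2 ⟨m, Set.mem_Ioi.2 (by linarith)⟩
  · exact MeasurableSpace.isPiSystem_measurableSet.prod isPiSystem_Ioi
  · refine Set.eq_univ_of_forall fun x => ?_
    obtain ⟨m, hm⟩ := exists_nat_gt (-x.2)
    exact Set.mem_iUnion.2 ⟨m, Set.mem_univ _, Set.mem_Ioi.2 (by linarith)⟩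
  · exact fun m => Set.mem_image2_of_mem MeasurableSet.univ (Set.mem_range_self _)
  · exact fun m => measure_ne_top _ _
  · rintro _ ⟨B, hB, _, ⟨s, rfl⟩, rfl⟩
    rcases le_total 0 s with hs | hs
    · exact key B hB ⟨s, hs⟩
    · -- both measures live on the positive holding times
      have hB0 : MeasurableSet (B ×ˢ Set.Ioi s) := hB.prod measurableSet_Ioi
      have hsub : B ×ˢ Set.Ioi (((0 : ℝ≥0) : ℝ)) ⊆ B ×ˢ Set.Ioi s :=
        Set.prod_mono_right (Set.Ioi_subset_Ioi (by simpa using hs))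
      have h0 := key B hB 0
      have e1 : (μ.restrict ({ω | Y n ω = v} ∩ {ω | Y (n + 1) ω = u})).map
          (fun ω => (g ω, hold τ n ω)) (B ×ˢ Set.Ioi s)
          = (μ.restrict ({ω | Y n ω = v} ∩ {ω | Y (n + 1) ω = u})).map
          (fun ω => (g ω, hold τ n ω)) (B ×ˢ Set.Ioi (((0 : ℝ≥0) : ℝ))) := by
        rw [Measure.map_apply hpair hB0, Measure.map_apply hpair (hB.prod measurableSet_Ioi)]
        refine measure_congr ?_
        filter_upwards [ae_restrict_of_ae hJ.time_lt] with ω hω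
        have hp : 0 < hold τ n ω := by
          rw [hold, NNReal.coe_pos]; exact tsub_pos_of_lt (hω n)
        refine propext ⟨fun h => ⟨h.1, ?_⟩, fun h => hsub h⟩
        simpa using hp
      have e2 : (((μ.restrict {ω | Y n ω = v}).map g).prod
          (volume.restrict (Set.Ioi (0 : ℝ)))).withDensity
          (fun p => ENNReal.ofReal (rate G w (β p.1) v u
            * Real.exp (-(p.2 * totalRate G w (β p.1) v)))) (B ×ˢ Set.Ioi s)
          = (((μ.restrict {ω | Y n ω = v}).map g).prod
          (volume.restrict (Set.Ioi (0 : ℝ)))).withDensity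
          (fun p => ENNReal.ofReal (rate G w (β p.1) v u
            * Real.exp (-(p.2 * totalRate G w (β p.1) v))))
            (B ×ˢ Set.Ioi (((0 : ℝ≥0) : ℝ))) := by
        rw [withDensity_apply _ hB0, withDensity_apply _ (hB.prod measurableSet_Ioi),
          ← Measure.prod_restrict, ← Measure.prod_restrict,
          Measure.restrict_restrict measurableSet_Ioi, Measure.restrict_restrict measurableSet_Ioi]
        have hset : Set.Ioi s ∩ Set.Ioi 0 = Set.Ioi (((0 : ℝ≥0) : ℝ)) ∩ Set.Ioi 0 := by
          rw [NNReal.coe_zero, Set.inter_self, Set.inter_eq_right]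
          exact Set.Ioi_subset_Ioi hs
        rw [hset]
      exact e1.trans (h0.trans e2.symm)

/-- The expectation of a function of the history, of the `n`-th holding time and of the next
position is computed by averaging first over one step. -/
lemma lintegral_eq_stepMean [IsProbabilityMeasure μ] [Nontrivial V] (hG : G.Connected)
    (hw : IsStrongWeight a w)
    (hℓ : ∀ v, a ≤ ℓ v) (hJ : IsJumpChain G w ℓ μ τ Y) {E : Type*} [MeasurableSpace E] (n : ℕ)
    {g : Ω → E} (hg : Measurable[history τ Y n] g) {β : E → V → ℝ} (hβ : Measurable β)
    (hgβ : ∀ ω, β (g ω) = chainTime ℓ τ Y n ω) {φ : V → V → E × ℝ → ENNReal}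
    (hφ : ∀ v u, Measurable (φ v u)) :
    ∫⁻ ω, φ (Y n ω) (Y (n + 1) ω) (g ω, hold τ n ω) ∂μ
      = ∫⁻ ω, stepMean G w (chainTime ℓ τ Y n ω) (Y n ω)
        (fun s u => φ (Y n ω) u (g ω, s)) ∂μ := by
  have hg' : Measurable g := hg.mono (history_le hJ.measurable_time hJ.measurable_vertex n) le_rfl
  have hhold : Measurable (hold τ n) :=
    measurable_hold' (hJ.measurable_time n) (hJ.measurable_time (n + 1))
  have hpair : Measurable fun ω => (g ω, hold τ n ω) := hg'.prodMk hhold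
  have hdens : ∀ v u, Measurable fun p : E × ℝ => ENNReal.ofReal (rate G w (β p.1) v u
      * Real.exp (-(p.2 * totalRate G w (β p.1) v))) := by
    intro v u
    have h1 : Measurable fun p : E × ℝ => rate G w (β p.1) v u :=
      (measurable_rate hw v u).comp (hβ.comp measurable_fst)
    have h2 : Measurable fun p : E × ℝ => totalRate G w (β p.1) v :=
      (measurable_totalRate hw v).comp (hβ.comp measurable_fst)
    fun_prop
  rw [lintegral_eq_sum_vertex (hJ.measurable_vertex n)
      (fun v ω => φ v (Y (n + 1) ω) (g ω, hold τ n ω)),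
    lintegral_eq_sum_vertex (hJ.measurable_vertex n) (fun v ω => stepMean G w
      (chainTime ℓ τ Y n ω) v (fun s u => φ v u (g ω, s)))]
  refine Finset.sum_congr rfl fun v _ => ?_
  rw [lintegral_eq_sum_vertex (hJ.measurable_vertex (n + 1))
      (fun u ω => φ v u (g ω, hold τ n ω))]
  have hf : ∀ u, Measurable fun p : E × ℝ => ENNReal.ofReal (rate G w (β p.1) v u
      * Real.exp (-(p.2 * totalRate G w (β p.1) v))) * φ v u p := fun u =>
    (hdens v u).mul (hφ v u)
  unfold stepMean
  have hmeas : ∀ u, Measurable fun ω => ∫⁻ s in Set.Ioi (0 : ℝ),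
      ENNReal.ofReal (rate G w (chainTime ℓ τ Y n ω) v u
        * Real.exp (-(s * totalRate G w (chainTime ℓ τ Y n ω) v))) * φ v u (g ω, s) := by
    intro u
    simp only [← hgβ]
    exact (hf u).lintegral_prod_right'.comp hg'
  rw [lintegral_finsetSum _ fun u _ => hmeas u]
  refine Finset.sum_congr rfl fun u _ => ?_
  have hYn1 : MeasurableSet {ω | Y (n + 1) ω = u} :=
    hJ.measurable_vertex (n + 1) (t := {u}) trivial
  rw [Measure.restrict_restrict hYn1, Set.inter_comm, ← lintegral_map (hφ v u) hpair,
    map_hold_eq hG hw hℓ hJ n hg hβ hgβ v u,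
    lintegral_withDensity_eq_lintegral_mul _ (hdens v u) (hφ v u)]
  simp only [Pi.mul_apply]
  rw [lintegral_prod _ (hf u).aemeasurable, lintegral_map (hf u).lintegral_prod_right' hg']
  simp only [hgβ]

end Chain

/-! ### Second moments along the jump chain -/

section Moments

variable {Ω V : Type*} [Fintype V] {G : SimpleGraph V} {w : ℝ → ℝ} {a : ℝ}
  {ℓ : V → ℝ} {τ : ℕ → Ω → ℝ≥0} {Y : ℕ → Ω → V}

variable (G w a ℓ τ Y) in
/-- The `m`-th martingale increment attached to the vertices `i` and `k`. -/
def chainIncr (i k : V) (m : ℕ) (ω : Ω) : ℝ :=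
  stepIncr G w a i k (chainTime ℓ τ Y m ω) (Y m ω) (hold τ m ω) (Y (m + 1) ω)

variable (w a ℓ τ Y) in
/-- The total scaled local time after `n` jumps. -/
def totalScale (n : ℕ) (ω : Ω) : ℝ := ∑ v, scale w a (chainTime ℓ τ Y n ω v)

lemma sum_update_sub (h : ℝ → ℝ) (L : V → ℝ) (v : V) (y : ℝ) :
    ∑ x, h (Function.update L v y x) - ∑ x, h (L x) = h y - h (L v) := by
  rw [← Finset.sum_sub_distrib, Finset.sum_eq_single v]
  · simp
  · intro x _ hx; simp [Function.update_of_ne hx]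
  · simp

lemma totalScale_succ_sub (n : ℕ) (ω : Ω) :
    totalScale w a ℓ τ Y (n + 1) ω - totalScale w a ℓ τ Y n ω
      = scale w a (chainTime ℓ τ Y n ω (Y n ω) + hold τ n ω)
        - scale w a (chainTime ℓ τ Y n ω (Y n ω)) := by
  unfold totalScale
  rw [chainTime_succ]
  exact sum_update_sub _ _ _ _

variable (hw : IsStrongWeight a w)
include hw

lemma totalScale_mono (ω : Ω) : Monotone fun n => totalScale w a ℓ τ Y n ω :=
  fun _ _ h => Finset.sum_le_sum fun v _ => scale_mono hw (chainTime_mono ω v h)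

lemma totalScale_sub_le (hℓ : ∀ v, a ≤ ℓ v) (n N : ℕ) (ω : Ω) :
    totalScale w a ℓ τ Y N ω - totalScale w a ℓ τ Y n ω ≤ Fintype.card V * scaleTotal w a := by
  unfold totalScale
  rw [← Finset.sum_sub_distrib]
  calc _ ≤ ∑ v : V, scaleTotal w a :=
        Finset.sum_le_sum fun v _ => scale_sub_le hw (le_chainTime hℓ n ω v)
    _ = _ := by simp

lemma measurable_stepIncr (i k v u : V) :
    Measurable fun p : (V → ℝ) × ℝ => stepIncr G w a i k p.1 v p.2 u := by
  have h1 : Measurable fun p : (V → ℝ) × ℝ => w ∘ Function.update p.1 v (p.1 v + p.2) := by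
    refine measurable_pi_lambda _ fun x => hw.continuous.measurable.comp ?_
    by_cases hx : x = v
    · subst hx; simp only [Function.update_self]; fun_prop
    · simp only [Function.update_of_ne hx]; fun_prop
  have h2 := continuous_scale hw
  unfold stepIncr
  refine Measurable.add (Continuous.measurable (by fun_prop))
    (((measurable_potential i k u).comp h1).sub ((measurable_potential i k v).comp h1))

omit hw in
lemma measurable_vertex_comp {mΩ : MeasurableSpace Ω} {Z : Ω → V}
    (hZ : ∀ v, MeasurableSet {ω | Z ω = v}) {F : V → Ω → ℝ} (hF : ∀ v, Measurable (F v)) :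
    Measurable fun ω => F (Z ω) ω := by
  have : (fun ω => F (Z ω) ω) = fun ω => ∑ v, if Z ω = v then F v ω else 0 := by
    funext ω; simp
  rw [this]
  exact Finset.measurable_sum _ fun v _ => Measurable.ite (hZ v) (hF v) measurable_const

lemma measurable_chainIncr' {mΩ : MeasurableSpace Ω} (i k : V) {m : ℕ}
    (hL : Measurable (chainTime ℓ τ Y m)) (hh : Measurable (hold τ m))
    (hY : ∀ v, MeasurableSet {ω | Y m ω = v}) (hY' : ∀ v, MeasurableSet {ω | Y (m + 1) ω = v}) :
    Measurable (chainIncr G w a ℓ τ Y i k m) := by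
  unfold chainIncr
  refine measurable_vertex_comp (Z := Y m) hY (F := fun v ω =>
    stepIncr G w a i k (chainTime ℓ τ Y m ω) v (hold τ m ω) (Y (m + 1) ω)) fun v => ?_
  refine measurable_vertex_comp (Z := Y (m + 1)) hY' (F := fun u ω =>
    stepIncr G w a i k (chainTime ℓ τ Y m ω) v (hold τ m ω) u) fun u => ?_
  have h := (measurable_stepIncr (G := G) hw i k v u).comp (hL.prodMk hh)
  exact h

lemma measurable_chainIncr (i k : V) {m n : ℕ} (h : m < n) :
    Measurable[history τ Y n] (chainIncr G w a ℓ τ Y i k m) :=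
  measurable_chainIncr' (mΩ := history τ Y n) hw i k (measurable_chainTime h.le)
    (measurable_hold' (mΩ := history τ Y n) (measurable_history_time h.le)
      (measurable_history_time h))
    (fun v => measurableSet_history_eq h.le v) (fun v => measurableSet_history_eq h v)

lemma measurable_sum_chainIncr (i k : V) (n N : ℕ) : Measurable[history τ Y N]
    (fun ω => ∑ m ∈ Finset.Ico n N, chainIncr G w a ℓ τ Y i k m ω) :=
  @Finset.measurable_sum ℝ ℕ Ω _ _ _ (history τ Y N) _ _ fun _ hm =>
    measurable_chainIncr hw i k (Finset.mem_Ico.1 hm).2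

variable [MeasurableSpace Ω] {μ : Measure Ω} [IsProbabilityMeasure μ] [Nontrivial V]

/-- The second moment of the martingale started at time `n`, on an event of the history at that
time and normalised by the conductance of the edge `ik` at that time, is at most the mean increase
of the total scaled local time. -/
lemma lintegral_sq_sum_chainIncr_le (hG : G.Connected) (hℓ : ∀ v, a ≤ ℓ v)
    (hJ : IsJumpChain G w ℓ μ τ Y) {i k : V} (hik : G.Adj i k) {n : ℕ} {H : Set Ω}
    (hH : MeasurableSet[history τ Y n] H) {N : ℕ} (hN : n ≤ N) :
    ∫⁻ ω in H, ENNReal.ofReal (w (chainTime ℓ τ Y n ω i) * w (chainTime ℓ τ Y n ω k)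
        * (∑ m ∈ Finset.Ico n N, chainIncr G w a ℓ τ Y i k m ω) ^ 2) ∂μ
      ≤ ∫⁻ ω in H, ENNReal.ofReal
        (totalScale w a ℓ τ Y N ω - totalScale w a ℓ τ Y n ω) ∂μ := by
  have hH' : MeasurableSet H := history_le hJ.measurable_time hJ.measurable_vertex n H hH
  induction N, hN using Nat.le_induction with
  | base => simp
  | succ N hN ih =>
    set c : Ω → ℝ := fun ω => w (chainTime ℓ τ Y n ω i) * w (chainTime ℓ τ Y n ω k) with hc
    set b : Ω → ℝ := H.indicator c with hb
    set S : Ω → ℝ := fun ω => ∑ m ∈ Finset.Ico n N, chainIncr G w a ℓ τ Y i k m ω with hS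
    have hcpos : ∀ ω, 0 < c ω := fun ω => mul_pos (hw.pos _) (hw.pos _)
    have hbm : Measurable[history τ Y N] b := by
      have hL : Measurable[history τ Y N] (chainTime ℓ τ Y n) := measurable_chainTime hN
      have h1 : Measurable fun L : V → ℝ => w (L i) * w (L k) :=
        (hw.continuous.measurable.comp (measurable_pi_apply i)).mul
          (hw.continuous.measurable.comp (measurable_pi_apply k))
      have h2 : Measurable[history τ Y N] c := h1.comp hL
      exact h2.indicator (history_mono hN H hH)
    have hSm : Measurable[history τ Y N] S := measurable_sum_chainIncr hw i k n N
    have hg : Measurable[history τ Y N] fun ω => (chainTime ℓ τ Y N ω, S ω, b ω) :=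
      Measurable.prodMk (measurable_chainTime le_rfl) (hSm.prodMk hbm)
    have hsc := continuous_scale hw
    have hwc := hw.continuous
    have e1 := lintegral_eq_stepMean hG hw hℓ hJ N hg (β := Prod.fst) measurable_fst
      (fun _ => rfl) (φ := fun v u p => ENNReal.ofReal p.1.2.2
        * ENNReal.ofReal ((p.1.2.1 + stepIncr G w a i k p.1.1 v p.2 u) ^ 2))
      (fun v u => by
        have h1 : Measurable fun p : ((V → ℝ) × ℝ × ℝ) × ℝ =>
            stepIncr G w a i k p.1.1 v p.2 u := by
          have hm : Measurable fun p : ((V → ℝ) × ℝ × ℝ) × ℝ => (p.1.1, p.2) := by fun_prop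
          have h := (measurable_stepIncr (G := G) hw i k v u).comp hm
          exact h
        fun_prop)
    have e2 := lintegral_eq_stepMean hG hw hℓ hJ N hg (β := Prod.fst) measurable_fst
      (fun _ => rfl) (φ := fun v _ p => ENNReal.ofReal p.1.2.2
        * ENNReal.ofReal (p.1.2.1 ^ 2 + (w (p.1.1 i) * w (p.1.1 k))⁻¹
          * (scale w a (p.1.1 v + p.2) - scale w a (p.1.1 v))))
      (fun v _ => by
        have hv : ∀ x, Measurable fun p : ((V → ℝ) × ℝ × ℝ) × ℝ => p.1.1 x := fun x =>
          (measurable_pi_apply x).comp (measurable_fst.comp measurable_fst)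
        have h1 : Measurable fun p : ((V → ℝ) × ℝ × ℝ) × ℝ => (w (p.1.1 i) * w (p.1.1 k))⁻¹ :=
          ((hwc.measurable.comp (hv i)).mul (hwc.measurable.comp (hv k))).inv
        have h2 : Measurable fun p : ((V → ℝ) × ℝ × ℝ) × ℝ =>
            scale w a (p.1.1 v + p.2) - scale w a (p.1.1 v) :=
          (hsc.measurable.comp ((hv v).add measurable_snd)).sub (hsc.measurable.comp (hv v))
        have h3 : Measurable fun p : ((V → ℝ) × ℝ × ℝ) × ℝ => p.1.2.1 :=
          measurable_fst.comp (measurable_snd.comp measurable_fst)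
        have h4 : Measurable fun p : ((V → ℝ) × ℝ × ℝ) × ℝ => p.1.2.2 :=
          measurable_snd.comp (measurable_snd.comp measurable_fst)
        exact h4.ennreal_ofReal.mul ((h3.pow_const 2).add (h1.mul h2)).ennreal_ofReal)
    have hpull : ∀ (r : ℝ) (L : V → ℝ) (v : V) (φ : ℝ → V → ENNReal),
        stepMean G w L v (fun s u => ENNReal.ofReal r * φ s u)
          = ENNReal.ofReal r * stepMean G w L v φ := by
      intro r L v φ
      unfold stepMean
      rw [Finset.mul_sum]
      refine Finset.sum_congr rfl fun u _ => ?_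
      rw [← lintegral_const_mul' _ _ ENNReal.ofReal_ne_top]
      exact lintegral_congr fun s => mul_left_comm _ _ _
    have hsplit : ∀ (f : Ω → ℝ), ∫⁻ ω in H, ENNReal.ofReal (c ω * f ω) ∂μ
        = ∫⁻ ω, ENNReal.ofReal (b ω) * ENNReal.ofReal (f ω) ∂μ := by
      intro f
      rw [← lintegral_indicator hH']
      refine lintegral_congr fun ω => ?_
      by_cases h : ω ∈ H
      · simp only [hb, Set.indicator_of_mem h, ENNReal.ofReal_mul (hcpos ω).le]
      · simp [hb, Set.indicator_of_notMem h]
    calc ∫⁻ ω in H, ENNReal.ofReal (c ω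
          * (∑ m ∈ Finset.Ico n (N + 1), chainIncr G w a ℓ τ Y i k m ω) ^ 2) ∂μ
        = ∫⁻ ω, ENNReal.ofReal (b ω)
          * ENNReal.ofReal ((S ω + chainIncr G w a ℓ τ Y i k N ω) ^ 2) ∂μ := by
          rw [hsplit]
          simp only [Finset.sum_Ico_succ_top hN, hS]
      _ ≤ ∫⁻ ω, ENNReal.ofReal (b ω) * ENNReal.ofReal (S ω ^ 2
          + (w (chainTime ℓ τ Y N ω i) * w (chainTime ℓ τ Y N ω k))⁻¹
            * (scale w a (chainTime ℓ τ Y N ω (Y N ω) + hold τ N ω)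
              - scale w a (chainTime ℓ τ Y N ω (Y N ω)))) ∂μ := by
          refine e1.le.trans (le_trans (lintegral_mono fun ω => ?_) e2.ge)
          simp only [hpull]
          exact mul_le_mul_right (stepMean_sq_le hw hG (le_chainTime hℓ N ω) hik (Y N ω) (S ω)) _
      _ = ∫⁻ ω in H, ENNReal.ofReal (c ω * (S ω ^ 2
          + (w (chainTime ℓ τ Y N ω i) * w (chainTime ℓ τ Y N ω k))⁻¹
            * (totalScale w a ℓ τ Y (N + 1) ω - totalScale w a ℓ τ Y N ω))) ∂μ := by
          rw [hsplit]; simp only [totalScale_succ_sub]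
      _ ≤ ∫⁻ ω in H, (ENNReal.ofReal (c ω * S ω ^ 2) + ENNReal.ofReal
            (totalScale w a ℓ τ Y (N + 1) ω - totalScale w a ℓ τ Y N ω)) ∂μ := by
          refine lintegral_mono fun ω => ?_
          have hd : 0 ≤ totalScale w a ℓ τ Y (N + 1) ω - totalScale w a ℓ τ Y N ω :=
            sub_nonneg.2 (totalScale_mono hw ω N.le_succ)
          rw [← ENNReal.ofReal_add (mul_nonneg (hcpos ω).le (sq_nonneg _)) hd]
          refine ENNReal.ofReal_le_ofReal ?_
          rw [mul_add, ← mul_assoc]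
          have hcle : c ω * (w (chainTime ℓ τ Y N ω i) * w (chainTime ℓ τ Y N ω k))⁻¹ ≤ 1 := by
            rw [← div_eq_mul_inv]
            refine (div_le_one (mul_pos (hw.pos _) (hw.pos _))).2 ?_
            exact mul_le_mul (hw.monotone (chainTime_mono ω i hN))
              (hw.monotone (chainTime_mono ω k hN)) (hw.pos _).le (hw.pos _).le
          have := mul_le_mul_of_nonneg_right hcle hd
          linarith
      _ = ∫⁻ ω in H, ENNReal.ofReal (c ω * S ω ^ 2) ∂μ + ∫⁻ ω in H, ENNReal.ofReal
            (totalScale w a ℓ τ Y (N + 1) ω - totalScale w a ℓ τ Y N ω) ∂μ := by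
          refine lintegral_add_left ?_ _
          have hcm : Measurable c := by
            have hL : Measurable (chainTime ℓ τ Y n) := (measurable_chainTime le_rfl).mono
              (history_le hJ.measurable_time hJ.measurable_vertex n) le_rfl
            have h1 : Measurable fun L : V → ℝ => w (L i) * w (L k) :=
              (hw.continuous.measurable.comp (measurable_pi_apply i)).mul
                (hw.continuous.measurable.comp (measurable_pi_apply k))
            exact h1.comp hL
          have hSm' : Measurable S :=
            hSm.mono (history_le hJ.measurable_time hJ.measurable_vertex N) le_rfl
          exact (hcm.mul (hSm'.pow_const 2)).ennreal_ofReal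
      _ ≤ ∫⁻ ω in H, ENNReal.ofReal (totalScale w a ℓ τ Y N ω - totalScale w a ℓ τ Y n ω) ∂μ
          + ∫⁻ ω in H, ENNReal.ofReal
            (totalScale w a ℓ τ Y (N + 1) ω - totalScale w a ℓ τ Y N ω) ∂μ := by gcongr
      _ = _ := by
          have htm : ∀ m, Measurable fun ω => totalScale w a ℓ τ Y m ω := by
            intro m
            have hL : Measurable (chainTime ℓ τ Y m) := (measurable_chainTime le_rfl).mono
              (history_le hJ.measurable_time hJ.measurable_vertex m) le_rfl
            exact Finset.measurable_sum _ fun v _ =>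
              hsc.measurable.comp ((measurable_pi_apply v).comp hL)
          have hmm : Measurable fun ω => ENNReal.ofReal
              (totalScale w a ℓ τ Y N ω - totalScale w a ℓ τ Y n ω) :=
            ((htm N).sub (htm n)).ennreal_ofReal
          rw [← lintegral_add_left hmm]
          refine lintegral_congr fun ω => ?_
          rw [← ENNReal.ofReal_add (sub_nonneg.2 (totalScale_mono hw ω hN))
            (sub_nonneg.2 (totalScale_mono hw ω N.le_succ))]
          congr 1; ring

omit [MeasurableSpace Ω] [Nontrivial V] in
/-- Pathwise comparison of the scaled local times at the ends of an edge: up to the martingale,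
their increments differ by at most a multiple of the inverse square root of the conductance. -/
lemma abs_scale_sub_sub_sum_le (hG : G.Connected) (hℓ : ∀ v, a ≤ ℓ v) {i k : V} (hik : G.Adj i k)
    (ω : Ω) {n N : ℕ} (hN : n ≤ N) :
    |(scale w a (chainTime ℓ τ Y N ω i) - scale w a (chainTime ℓ τ Y n ω i))
      - (scale w a (chainTime ℓ τ Y N ω k) - scale w a (chainTime ℓ τ Y n ω k))
      - ∑ m ∈ Finset.Ico n N, chainIncr G w a ℓ τ Y i k m ω|
      ≤ (2 * Fintype.card V + 1) / w a
        / √(w (chainTime ℓ τ Y n ω i) * w (chainTime ℓ τ Y n ω k)) := by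
  set L : ℕ → V → ℝ := fun m => chainTime ℓ τ Y m ω with hL
  set c : ℝ := w (L n i) * w (L n k) with hc
  have ha := hw.pos a
  have hcpos : 0 < c := mul_pos (hw.pos _) (hw.pos _)
  have hLa : ∀ m v, w a ≤ w (L m v) := fun m v => hw.monotone (le_chainTime hℓ m ω v)
  set D : ℝ := 2 / √(c * w a) with hD
  set R : ℕ → ℝ := fun m => ∑ v, 1 / √(w (L m v)) with hR
  set f : ℕ → ℝ := fun m => potential G (w ∘ L m) i k (Y m ω) with hf
  -- per step, the error is the change of the potential at the vertex where the time is spent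
  have hstep : ∀ m, n ≤ m → |(scale w a (L (m + 1) i) - scale w a (L m i))
      - (scale w a (L (m + 1) k) - scale w a (L m k)) + (f (m + 1) - f m)
      - chainIncr G w a ℓ τ Y i k m ω| ≤ D * (R m - R (m + 1)) := by
    intro m hm
    set v := Y m ω with hv
    have hsucc : L (m + 1) = Function.update (L m) v (L m v + hold τ m ω) := chainTime_succ m ω
    have hpot := abs_potential_update_sub_le_inv_sqrt hG (q := w ∘ L m) (q' := w ∘ L (m + 1)) ha
      (fun x => hLa m x) (i := i) (k := k) (v := v) hik
      (hw.monotone (chainTime_mono ω v m.le_succ)) (fun u hu => by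
        simp only [Function.comp_apply, hsucc, Function.update_of_ne hu])
    simp only [Function.comp_apply] at hpot
    have hx : ∀ x, scale w a (L (m + 1) x) - scale w a (L m x)
        = (if v = x then 1 else 0)
          * (scale w a (L m v + hold τ m ω) - scale w a (L m v)) := by
      intro x
      by_cases h : v = x
      · subst h; rw [hsucc, Function.update_self, if_pos rfl, one_mul]
      · rw [hsucc, Function.update_of_ne (Ne.symm h), if_neg h, sub_self, zero_mul]
    have hid : (scale w a (L (m + 1) i) - scale w a (L m i))
        - (scale w a (L (m + 1) k) - scale w a (L m k)) + (f (m + 1) - f m)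
        - chainIncr G w a ℓ τ Y i k m ω
        = potential G (w ∘ L (m + 1)) i k v - potential G (w ∘ L m) i k v := by
      rw [hx i, hx k]
      simp only [chainIncr, stepIncr, hf]
      rw [← hv]
      change _ - ((_ : ℝ) + (potential G (w ∘ Function.update (L m) v (L m v + hold τ m ω)) i k _
        - potential G (w ∘ Function.update (L m) v (L m v + hold τ m ω)) i k v)) = _
      rw [← hsucc]
      simp only [hL]
      ring
    have hRR : R m - R (m + 1) = 1 / √(w (L m v)) - 1 / √(w (L (m + 1) v)) := by
      have h := sum_update_sub (fun x => 1 / √(w x)) (L m) v (L m v + hold τ m ω)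
      rw [← hsucc] at h
      have e : L (m + 1) v = L m v + hold τ m ω := by rw [hsucc, Function.update_self]
      rw [e]
      simp only [hR]
      linarith
    rw [hid, hRR]
    refine hpot.trans (mul_le_mul_of_nonneg_right ?_ ?_)
    · refine div_le_div_of_nonneg_left zero_le_two (Real.sqrt_pos.2 (by positivity))
        (Real.sqrt_le_sqrt (mul_le_mul_of_nonneg_right ?_ ha.le))
      exact mul_le_mul (hw.monotone (chainTime_mono ω i hm))
        (hw.monotone (chainTime_mono ω k hm)) (hw.pos _).le (hw.pos _).le
    · exact sub_nonneg.2 (one_div_le_one_div_of_le (Real.sqrt_pos.2 (hw.pos _))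
        (Real.sqrt_le_sqrt (hw.monotone (chainTime_mono ω v m.le_succ))))
  have htele : |(scale w a (L N i) - scale w a (L n i))
      - (scale w a (L N k) - scale w a (L n k)) + (f N - f n)
      - ∑ m ∈ Finset.Ico n N, chainIncr G w a ℓ τ Y i k m ω| ≤ D * (R n - R N) := by
    induction N, hN using Nat.le_induction with
    | base => simp
    | succ N hN ih =>
      rw [Finset.sum_Ico_succ_top hN]
      refine le_trans (le_of_eq ?_) ((abs_add_le _ _).trans
        ((add_le_add ih (hstep N hN)).trans (le_of_eq ?_)))
      · congr 1; ring
      · ring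
  have hDpos : 0 ≤ D := by positivity
  have hR1 : R n - R N ≤ Fintype.card V / √(w a) := by
    have h1 : R n ≤ ∑ v : V, 1 / √(w a) := Finset.sum_le_sum fun v _ =>
      one_div_le_one_div_of_le (Real.sqrt_pos.2 ha) (Real.sqrt_le_sqrt (hLa n v))
    have h2 : 0 ≤ R N := Finset.sum_nonneg fun v _ => by positivity
    have h3 : ∑ v : V, 1 / √(w a) = Fintype.card V / √(w a) := by simp [div_eq_mul_inv]
    linarith
  have hDR : D * (R n - R N) ≤ 2 * Fintype.card V / w a / √c := by
    refine (mul_le_mul_of_nonneg_left hR1 hDpos).trans (le_of_eq ?_)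
    rw [hD, Real.sqrt_mul hcpos.le]
    have h1 : √(w a) ≠ 0 := (Real.sqrt_pos.2 ha).ne'
    have h2 : √c ≠ 0 := (Real.sqrt_pos.2 hcpos).ne'
    have h3 : w a = √(w a) * √(w a) := (Real.mul_self_sqrt ha.le).symm
    rw [div_mul_div_comm, div_div]
    congr 1
    rw [mul_assoc, ← h3]; ring
  have hsc : w a ≤ √c := by
    rw [Real.le_sqrt ha.le hcpos.le, sq]
    exact mul_le_mul (hLa n i) (hLa n k) ha.le (hw.pos _).le
  have hfb : ∀ m, n ≤ m → 0 ≤ f m ∧ f m ≤ 1 / w a / √c := by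
    intro m hm
    refine ⟨potential_nonneg hG (fun x => hw.pos _) _ _ _, ?_⟩
    have h1 := (potential_le hG (q := w ∘ L m) (fun x => hw.pos _) i k (Y m ω)).trans
      (potential_le_inv hG (fun x => hw.pos _) hik)
    refine h1.trans ?_
    have h2 : c ≤ (w ∘ L m) i * (w ∘ L m) k :=
      mul_le_mul (hw.monotone (chainTime_mono ω i hm))
        (hw.monotone (chainTime_mono ω k hm)) (hw.pos _).le (hw.pos _).le
    refine (inv_anti₀ hcpos h2).trans ?_
    have h3 : c = √c * √c := (Real.mul_self_sqrt hcpos.le).symm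
    have h4 : 0 < √c := Real.sqrt_pos.2 hcpos
    rw [div_div, one_div]
    refine inv_anti₀ (by positivity) ?_
    calc w a * √c ≤ √c * √c := by gcongr
      _ = c := h3.symm
  have hff : |f N - f n| ≤ 1 / w a / √c := by
    obtain ⟨h1, h2⟩ := hfb N hN
    obtain ⟨h3, h4⟩ := hfb n le_rfl
    rw [abs_le]; constructor <;> linarith
  have hfin : (2 * (Fintype.card V : ℝ) + 1) / w a / √c
      = 2 * Fintype.card V / w a / √c + 1 / w a / √c := by
    rw [add_div, add_div]
  change |(scale w a (L N i) - scale w a (L n i)) - (scale w a (L N k) - scale w a (L n k))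
      - ∑ m ∈ Finset.Ico n N, chainIncr G w a ℓ τ Y i k m ω| ≤ _ / √c
  rw [hfin]
  have h5 := abs_le.1 (htele.trans hDR)
  have h6 := abs_le.1 hff
  rw [abs_le]; constructor <;> linarith [h5.1, h5.2, h6.1, h6.2]

end Moments

/-! ### Comparison of the local times at the ends of an edge -/

section Comparison

variable {Ω V : Type*} [Fintype V] {G : SimpleGraph V} {w : ℝ → ℝ} {a : ℝ}
  {ℓ : V → ℝ} {τ : ℕ → Ω → ℝ≥0} {Y : ℕ → Ω → V} (hw : IsStrongWeight a w)
include hw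

/-- If the local time at `i` is large and much smaller than the one at its neighbour `k`, then it
can only diverge if the martingale becomes large: the remaining scaled local time at `k` is too
small to match the one at `i`. -/
lemma eventually_le_sq_sum_chainIncr (ha : 0 < a) (hG : G.Connected) (hℓ : ∀ v, a ≤ ℓ v) {i k : V}
    (hik : G.Adj i k) {Γ c R : ℝ} (hΓ1 : 1 ≤ Γ) (hc : 0 < c)
    (hΓ : ∀ x, a ≤ x →
      scaleTotal w a - scale w a (Γ * x) ≤ (scaleTotal w a - scale w a x) / 2)
    (hlow : ∀ x, a ≤ x → c * x ≤ w x * (scaleTotal w a - scale w a x))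
    (hR : 0 < R) (hR8 : 8 * ((2 * Fintype.card V + 1) / w a) ≤ c * R) {n : ℕ} {ω : Ω}
    (hi : R ≤ chainTime ℓ τ Y n ω i) (hk : Γ * chainTime ℓ τ Y n ω i ≤ chainTime ℓ τ Y n ω k)
    (hlim : Tendsto (fun N => chainTime ℓ τ Y N ω i) atTop atTop) :
    ∀ᶠ N in atTop, c ^ 2 * R ^ 2 / 16 ≤ w (chainTime ℓ τ Y n ω i) * w (chainTime ℓ τ Y n ω k)
        * (∑ m ∈ Finset.Ico n N, chainIncr G w a ℓ τ Y i k m ω) ^ 2 := by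
  set x := chainTime ℓ τ Y n ω i with hx
  set y := chainTime ℓ τ Y n ω k with hy
  set T := scaleTotal w a - scale w a x with hT
  set C := (2 * (Fintype.card V : ℝ) + 1) / w a with hC
  have hxa : a ≤ x := le_chainTime hℓ n ω i
  have hx0 : 0 < x := ha.trans_le hxa
  have hwx := hw.pos x
  have hcx : c * R ≤ w x * T := (mul_le_mul_of_nonneg_left hi hc.le).trans (hlow x hxa)
  have hTpos : 0 < T := by
    have : 0 < w x * T := (mul_pos hc hR).trans_le hcx
    exact pos_of_mul_pos_right this hwx.le
  have hxy : x ≤ y := by nlinarith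
  have hlim' : Tendsto (fun N => scale w a (chainTime ℓ τ Y N ω i) - scale w a x) atTop (𝓝 T) :=
    ((tendsto_scale hw).comp hlim).sub_const _
  filter_upwards [hlim'.eventually (lt_mem_nhds (show 7 / 8 * T < T by linarith)),
    eventually_ge_atTop n] with N hN hnN
  have h1 := abs_scale_sub_sub_sum_le (τ := τ) (Y := Y) hw hG hℓ hik ω hnN
  rw [← hx, ← hy, ← hC] at h1
  set S := ∑ m ∈ Finset.Ico n N, chainIncr G w a ℓ τ Y i k m ω
  have h2 : scale w a (chainTime ℓ τ Y N ω k) - scale w a y ≤ T / 2 := by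
    have e1 := scale_le_total hw (chainTime ℓ τ Y N ω k)
    have e2 := scale_mono hw hk
    have e3 := hΓ x hxa
    linarith
  have hsq : w x ≤ √(w x * w y) := by
    rw [Real.le_sqrt hwx.le (mul_pos hwx (hw.pos y)).le, sq]
    exact mul_le_mul_of_nonneg_left (hw.monotone hxy) hwx.le
  have hCpos : 0 ≤ C := div_nonneg (by positivity) (hw.pos a).le
  have h3 : C / √(w x * w y) ≤ T / 8 := by
    refine (div_le_div_of_nonneg_left hCpos hwx hsq).trans ?_
    rw [div_le_iff₀ hwx]
    linarith
  have h4 := (abs_le.1 (h1.trans h3)).2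
  have hS : T / 4 ≤ S := by linarith
  calc c ^ 2 * R ^ 2 / 16 = (c * R) ^ 2 / 16 := by ring
    _ ≤ (w x * T) ^ 2 / 16 := by gcongr
    _ = w x * w x * (T / 4) ^ 2 := by ring
    _ ≤ w x * w y * S ^ 2 := by
      have := hw.monotone hxy
      have := hw.pos y
      gcongr

variable [MeasurableSpace Ω] {μ : Measure Ω} [IsProbabilityMeasure μ] [Nontrivial V]

lemma measure_inter_tendsto_le (ha : 0 < a) (hG : G.Connected) (hℓ : ∀ v, a ≤ ℓ v)
    (hJ : IsJumpChain G w ℓ μ τ Y) {i k : V}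
    (hik : G.Adj i k) {Γ c R : ℝ} (hΓ1 : 1 ≤ Γ) (hc : 0 < c)
    (hΓ : ∀ x, a ≤ x →
      scaleTotal w a - scale w a (Γ * x) ≤ (scaleTotal w a - scale w a x) / 2)
    (hlow : ∀ x, a ≤ x → c * x ≤ w x * (scaleTotal w a - scale w a x))
    (hR : 0 < R) (hR8 : 8 * ((2 * Fintype.card V + 1) / w a) ≤ c * R) {n : ℕ} {H : Set Ω}
    (hH : MeasurableSet[history τ Y n] H)
    (hHi : ∀ ω ∈ H, R ≤ chainTime ℓ τ Y n ω i ∧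
      Γ * chainTime ℓ τ Y n ω i ≤ chainTime ℓ τ Y n ω k) :
    ENNReal.ofReal (c ^ 2 * R ^ 2 / 16)
        * μ (H ∩ {ω | Tendsto (fun N => chainTime ℓ τ Y N ω i) atTop atTop})
      ≤ ENNReal.ofReal (Fintype.card V * scaleTotal w a) * μ H := by
  have hH' : MeasurableSet H := history_le hJ.measurable_time hJ.measurable_vertex n H hH
  set f : ℕ → Ω → ENNReal := fun N => H.indicator fun ω =>
    ENNReal.ofReal (w (chainTime ℓ τ Y n ω i) * w (chainTime ℓ τ Y n ω k)
        * (∑ m ∈ Finset.Ico n N, chainIncr G w a ℓ τ Y i k m ω) ^ 2) with hf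
  have hfm : ∀ N, Measurable (f N) := by
    intro N
    refine Measurable.indicator ?_ hH'
    have hL : Measurable (chainTime ℓ τ Y n) := (measurable_chainTime le_rfl).mono
      (history_le hJ.measurable_time hJ.measurable_vertex n) le_rfl
    have h1 : Measurable fun L : V → ℝ => w (L i) * w (L k) :=
      (hw.continuous.measurable.comp (measurable_pi_apply i)).mul
        (hw.continuous.measurable.comp (measurable_pi_apply k))
    have h2 : Measurable fun ω => ∑ m ∈ Finset.Ico n N, chainIncr G w a ℓ τ Y i k m ω :=
      (measurable_sum_chainIncr hw i k n N).mono
        (history_le hJ.measurable_time hJ.measurable_vertex N) le_rfl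
    exact ((h1.comp hL).mul (h2.pow_const 2)).ennreal_ofReal
  have hfle : ∀ N, n ≤ N → ∫⁻ ω, f N ω ∂μ
      ≤ ENNReal.ofReal (Fintype.card V * scaleTotal w a) * μ H := by
    intro N hN
    rw [lintegral_indicator hH']
    refine (lintegral_sq_sum_chainIncr_le hw hG hℓ hJ hik hH hN).trans ?_
    rw [← setLIntegral_const]
    exact lintegral_mono fun ω => ENNReal.ofReal_le_ofReal (totalScale_sub_le hw hℓ n N ω)
  calc ENNReal.ofReal (c ^ 2 * R ^ 2 / 16)
        * μ (H ∩ {ω | Tendsto (fun N => chainTime ℓ τ Y N ω i) atTop atTop})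
      ≤ ENNReal.ofReal (c ^ 2 * R ^ 2 / 16)
        * μ {ω | ENNReal.ofReal (c ^ 2 * R ^ 2 / 16) ≤ liminf (fun N => f N ω) atTop} := by
        refine mul_le_mul_right (measure_mono ?_) _
        rintro ω ⟨hωH, hlim⟩
        change ENNReal.ofReal (c ^ 2 * R ^ 2 / 16) ≤ liminf (fun N => f N ω) atTop
        refine le_liminf_of_le (by isBoundedDefault) ?_
        filter_upwards [eventually_le_sq_sum_chainIncr hw ha hG hℓ hik hΓ1 hc hΓ hlow hR hR8
          (hHi ω hωH).1 (hHi ω hωH).2 hlim] with N hN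
        simp only [hf, Set.indicator_of_mem hωH]
        exact ENNReal.ofReal_le_ofReal hN
    _ ≤ ∫⁻ ω, liminf (fun N => f N ω) atTop ∂μ :=
        mul_meas_ge_le_lintegral (Measurable.liminf hfm) _
    _ ≤ liminf (fun N => ∫⁻ ω, f N ω ∂μ) atTop := lintegral_liminf_le hfm
    _ ≤ _ := by
        refine liminf_le_of_frequently_le' (Eventually.frequently ?_)
        filter_upwards [eventually_ge_atTop n] with N hN using hfle N hN

/-- Almost surely, wherever the local time at a vertex diverges, the local times at its neighbours
are eventually less than `Γ` times as large. -/
lemma ae_eventually_chainTime_lt (ha : 0 < a) (hG : G.Connected) (hℓ : ∀ v, a ≤ ℓ v)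
    (hJ : IsJumpChain G w ℓ μ τ Y) {i k : V}
    (hik : G.Adj i k) {Γ c : ℝ} (hΓ1 : 1 ≤ Γ) (hc : 0 < c)
    (hΓ : ∀ x, a ≤ x →
      scaleTotal w a - scale w a (Γ * x) ≤ (scaleTotal w a - scale w a x) / 2)
    (hlow : ∀ x, a ≤ x → c * x ≤ w x * (scaleTotal w a - scale w a x)) :
    ∀ᵐ ω ∂μ, Tendsto (fun N => chainTime ℓ τ Y N ω i) atTop atTop →
      ∀ᶠ n in atTop, chainTime ℓ τ Y n ω k < Γ * chainTime ℓ τ Y n ω i := by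
  set A : Set Ω := {ω | Tendsto (fun N => chainTime ℓ τ Y N ω i) atTop atTop} with hA
  set bad : Set Ω := {ω | ¬ (Tendsto (fun N => chainTime ℓ τ Y N ω i) atTop atTop →
      ∀ᶠ n in atTop, chainTime ℓ τ Y n ω k < Γ * chainTime ℓ τ Y n ω i)} with hbad
  change μ bad = 0
  set M := Fintype.card V * scaleTotal w a with hM
  have key : ∀ R : ℝ, 0 < R → 8 * ((2 * Fintype.card V + 1) / w a) ≤ c * R →
      ENNReal.ofReal (c ^ 2 * R ^ 2 / 16) * μ bad ≤ ENNReal.ofReal M := by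
    intro R hR hR8
    -- the events that the two local times are badly unbalanced at time `n`
    set B : ℕ → Set Ω := fun n => {ω | R ≤ chainTime ℓ τ Y n ω i ∧
      Γ * chainTime ℓ τ Y n ω i ≤ chainTime ℓ τ Y n ω k} with hB
    have hBm : ∀ m n, m ≤ n → MeasurableSet[history τ Y n] (B m) := by
      intro m n hmn
      have hs1 : MeasurableSet {L : V → ℝ | R ≤ L i} :=
        measurableSet_le measurable_const (measurable_pi_apply i)
      have hs2 : MeasurableSet {L : V → ℝ | Γ * L i ≤ L k} :=
        measurableSet_le (by fun_prop) (measurable_pi_apply k)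
      have hs : MeasurableSet {L : V → ℝ | R ≤ L i ∧ Γ * L i ≤ L k} := hs1.inter hs2
      exact measurable_chainTime (ℓ := ℓ) hmn hs
    -- decomposition according to the first such time
    have hHm : ∀ n, MeasurableSet[history τ Y n] (disjointed B n) := by
      intro n
      rw [disjointed_eq_inter_compl]
      exact (hBm n n le_rfl).inter (MeasurableSet.iInter fun m =>
        MeasurableSet.iInter fun hm => (hBm m n hm.le).compl)
    have hsub : bad ⊆ ⋃ n, (disjointed B n ∩ A) := by
      intro ω hω
      have hω' : ω ∈ A ∧ ∃ᶠ n in atTop, Γ * chainTime ℓ τ Y n ω i ≤ chainTime ℓ τ Y n ω k := by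
        have h : ¬ (Tendsto (fun N => chainTime ℓ τ Y N ω i) atTop atTop →
          ∀ᶠ n in atTop, chainTime ℓ τ Y n ω k < Γ * chainTime ℓ τ Y n ω i) := hω
        rw [Classical.not_imp] at h
        refine ⟨h.1, fun h' => h.2 ?_⟩
        filter_upwards [h'] with n hn using not_le.1 hn
      obtain ⟨n, hn, hn'⟩ := (hω'.2.and_eventually (hω'.1.eventually_ge_atTop R)).exists
      rw [← Set.iUnion_inter, iUnion_disjointed]
      exact ⟨Set.mem_iUnion.2 ⟨n, hn', hn⟩, hω'.1⟩
    calc ENNReal.ofReal (c ^ 2 * R ^ 2 / 16) * μ bad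
        ≤ ENNReal.ofReal (c ^ 2 * R ^ 2 / 16) * ∑' n, μ (disjointed B n ∩ A) :=
          mul_le_mul_right ((measure_mono hsub).trans (measure_iUnion_le _)) _
      _ = ∑' n, ENNReal.ofReal (c ^ 2 * R ^ 2 / 16) * μ (disjointed B n ∩ A) :=
          ENNReal.tsum_mul_left.symm
      _ ≤ ∑' n, ENNReal.ofReal M * μ (disjointed B n) :=
          ENNReal.tsum_le_tsum fun n => measure_inter_tendsto_le hw ha hG hℓ hJ hik hΓ1 hc hΓ hlow
            hR hR8 (hHm n) fun ω hω => disjointed_subset B n hω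
      _ = ENNReal.ofReal M * μ (⋃ n, disjointed B n) := by
          rw [ENNReal.tsum_mul_left, measure_iUnion (disjoint_disjointed B) fun n =>
            history_le hJ.measurable_time hJ.measurable_vertex n _ (hHm n)]
      _ ≤ ENNReal.ofReal M * 1 := mul_le_mul_right prob_le_one _
      _ = _ := mul_one _
  by_contra hne
  have hpos : 0 < (μ bad).toReal := ENNReal.toReal_pos hne (measure_ne_top _ _)
  have hlim : Tendsto (fun R : ℝ => c ^ 2 * R ^ 2 / 16 * (μ bad).toReal) atTop atTop := by
    refine Tendsto.atTop_mul_const hpos (Tendsto.atTop_div_const (by norm_num) ?_)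
    exact Tendsto.const_mul_atTop (by positivity) (tendsto_pow_atTop two_ne_zero)
  obtain ⟨R, ⟨h1, h2⟩, h3⟩ := ((hlim.eventually_gt_atTop (max M 0)).and
    (eventually_gt_atTop 0)|>.and
    ((tendsto_id.const_mul_atTop hc).eventually_ge_atTop
      (8 * ((2 * Fintype.card V + 1) / w a)))).exists
  have h4 := ENNReal.toReal_mono ENNReal.ofReal_ne_top (key R h2 h3)
  rw [ENNReal.toReal_mul, ENNReal.toReal_ofReal (by positivity), ENNReal.toReal_ofReal'] at h4
  linarith

/-- Almost surely, there are only finitely many jumps from `x` to `y` while the local times at `x`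
and `y` are at most `K`. -/
lemma ae_not_frequently_jump (hG : G.Connected) (hℓ : ∀ v, a ≤ ℓ v)
    (hJ : IsJumpChain G w ℓ μ τ Y) (x y : V) (K : ℝ) :
    ∀ᵐ ω ∂μ, ∀ᶠ n in atTop, ¬ ((Y n ω = x ∧ chainTime ℓ τ Y n ω x ≤ K ∧
      chainTime ℓ τ Y n ω y ≤ K) ∧ Y (n + 1) ω = y) := by
  set C := w K * w (K + 1) * (1 + (w a)⁻¹) with hC
  have hCpos : 0 ≤ C := by
    have := hw.pos K; have := hw.pos (K + 1); have := hw.pos a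
    positivity
  have hsc := continuous_scale hw
  have hY : ∀ n v, MeasurableSet {ω | Y n ω = v} := fun n v =>
    hJ.measurable_vertex n (t := {v}) trivial
  have hL : ∀ n, Measurable (chainTime ℓ τ Y n) := fun n => (measurable_chainTime le_rfl).mono
      (history_le hJ.measurable_time hJ.measurable_vertex n) le_rfl
  have hstep : ∀ n, μ {ω | (Y n ω = x ∧ chainTime ℓ τ Y n ω x ≤ K ∧
      chainTime ℓ τ Y n ω y ≤ K) ∧ Y (n + 1) ω = y}
      ≤ ∫⁻ ω, ENNReal.ofReal
        (C * (totalScale w a ℓ τ Y (n + 1) ω - totalScale w a ℓ τ Y n ω)) ∂μ := by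
    intro n
    have hset : MeasurableSet {p : (V → ℝ) × ℝ | p.1 x ≤ K ∧ p.1 y ≤ K} :=
      (measurableSet_le ((measurable_pi_apply x).comp measurable_fst) measurable_const).inter
        (measurableSet_le ((measurable_pi_apply y).comp measurable_fst) measurable_const)
    have hprop : ∀ v, MeasurableSet {p : (V → ℝ) × ℝ | v = x ∧ p.1 x ≤ K ∧ p.1 y ≤ K} := by
      intro v
      by_cases hv : v = x
      · simpa [hv] using hset
      · simp [hv]
    have e1 := lintegral_eq_stepMean hG hw hℓ hJ n
      (measurable_chainTime (ℓ := ℓ) (τ := τ) (Y := Y) (le_refl n)) (β := id) measurable_id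
      (fun _ => rfl) (φ := fun v u p => if v = x ∧ p.1 x ≤ K ∧ p.1 y ≤ K then
        (if u = y then 1 else 0) else 0)
      (fun v u => Measurable.ite (hprop v) measurable_const measurable_const)
    have e2 := lintegral_eq_stepMean hG hw hℓ hJ n
      (measurable_chainTime (ℓ := ℓ) (τ := τ) (Y := Y) (le_refl n)) (β := id) measurable_id
      (fun _ => rfl) (φ := fun v u p => if v = x ∧ p.1 x ≤ K ∧ p.1 y ≤ K then
        ENNReal.ofReal (C * (scale w a (p.1 x + p.2) - scale w a (p.1 x))) else 0)
      (fun v u => Measurable.ite (hprop v) (by fun_prop) measurable_const)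
    have hms : MeasurableSet {ω | (Y n ω = x ∧ chainTime ℓ τ Y n ω x ≤ K ∧
      chainTime ℓ τ Y n ω y ≤ K) ∧ Y (n + 1) ω = y} :=
      ((hY n x).inter ((measurableSet_le ((measurable_pi_apply x).comp (hL n))
        measurable_const).inter (measurableSet_le ((measurable_pi_apply y).comp (hL n))
        measurable_const))).inter (hY (n + 1) y)
    rw [← lintegral_indicator_one hms]
    calc ∫⁻ ω, Set.indicator {ω | (Y n ω = x ∧ chainTime ℓ τ Y n ω x ≤ K ∧
          chainTime ℓ τ Y n ω y ≤ K) ∧ Y (n + 1) ω = y} 1 ω ∂μ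
        = ∫⁻ ω, (if Y n ω = x ∧ chainTime ℓ τ Y n ω x ≤ K ∧ chainTime ℓ τ Y n ω y ≤ K then
          (if Y (n + 1) ω = y then 1 else 0) else 0) ∂μ := by
          refine lintegral_congr fun ω => ?_
          simp only [Set.indicator_apply, Set.mem_ofPred_eq, Pi.one_apply]
          split_ifs <;> simp_all
      _ ≤ ∫⁻ ω, (if Y n ω = x ∧ chainTime ℓ τ Y n ω x ≤ K ∧ chainTime ℓ τ Y n ω y ≤ K then
          ENNReal.ofReal (C * (scale w a (chainTime ℓ τ Y n ω x + hold τ n ω)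
            - scale w a (chainTime ℓ τ Y n ω x))) else 0) ∂μ := by
          refine e1.le.trans (le_trans (lintegral_mono fun ω => ?_) e2.ge)
          by_cases h : Y n ω = x ∧ chainTime ℓ τ Y n ω x ≤ K ∧ chainTime ℓ τ Y n ω y ≤ K
          · simp only [h.1, h.2, if_true, and_self]
            exact stepMean_jump_le hw hG (le_chainTime hℓ n ω) h.2.1 h.2.2
          · simp only [h, if_false]; exact le_rfl
      _ ≤ _ := by
          refine lintegral_mono fun ω => ?_
          simp only [totalScale_succ_sub]
          split_ifs with h
          · rw [h.1]
          · exact zero_le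
  refine ae_eventually_notMem (ne_top_of_le_ne_top
    (ENNReal.ofReal_ne_top (r := C * (Fintype.card V * scaleTotal w a))) ?_)
  refine (ENNReal.tsum_le_tsum hstep).trans ?_
  rw [ENNReal.tsum_eq_iSup_nat]
  refine iSup_le fun N => ?_
  have htm : ∀ m, Measurable fun ω => totalScale w a ℓ τ Y m ω := fun m =>
    Finset.measurable_sum _ fun v _ => hsc.measurable.comp ((measurable_pi_apply v).comp (hL m))
  have hdm : ∀ n, Measurable fun ω => ENNReal.ofReal
      (C * (totalScale w a ℓ τ Y (n + 1) ω - totalScale w a ℓ τ Y n ω)) := fun n =>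
    (((htm (n + 1)).sub (htm n)).const_mul C).ennreal_ofReal
  rw [← lintegral_finsetSum _ fun n _ => hdm n]
  have hle : ∀ ω, ∑ n ∈ Finset.range N, ENNReal.ofReal
      (C * (totalScale w a ℓ τ Y (n + 1) ω - totalScale w a ℓ τ Y n ω))
      ≤ ENNReal.ofReal (C * (Fintype.card V * scaleTotal w a)) := by
    intro ω
    rw [← ENNReal.ofReal_sum_of_nonneg fun n _ => mul_nonneg hCpos
      (sub_nonneg.2 (totalScale_mono hw ω n.le_succ)), ← Finset.mul_sum,
      Finset.sum_range_sub (fun n => totalScale w a ℓ τ Y n ω)]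
    exact ENNReal.ofReal_le_ofReal
      (mul_le_mul_of_nonneg_left (totalScale_sub_le hw hℓ 0 N ω) hCpos)
  calc _ ≤ ∫⁻ _, ENNReal.ofReal (C * (Fintype.card V * scaleTotal w a)) ∂μ := lintegral_mono hle
    _ = _ := by simp

end Comparison

/-! ### Reinforcement functions of polynomial growth -/

section PowerLaw

variable {a : ℝ} {w : ℝ → ℝ}

lemma isStrongWeight_max (hw_pos : ∀ x, a ≤ x → 0 < w x) (hw_mono : MonotoneOn w (Set.Ici a))
    (hw_int : IntegrableOn (fun x => 1 / w x) (Set.Ici a))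
    (hw_cont : ContinuousOn w (Set.Ici a)) : IsStrongWeight a fun x => w (max a x) where
  continuous := hw_cont.comp_continuous (continuous_const.max continuous_id)
    fun x => le_max_left a x
  monotone := fun x y hxy => hw_mono (le_max_left a x) (le_max_left a y) (max_le_max le_rfl hxy)
  pos := fun x => hw_pos _ (le_max_left a x)
  integrableOn := by
    refine (hw_int.mono_set Set.Ioi_subset_Ici_self).congr_fun (fun x hx => ?_) measurableSet_Ioi
    simp only [one_div, max_eq_right (Set.mem_Ioi.1 hx).le]

variable (hw : IsStrongWeight a w)
include hw

lemma div_le_scaleTotal_sub {x : ℝ} (hx : 0 ≤ x) :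
    x / w (2 * x) ≤ scaleTotal w a - scale w a x := by
  have h1 := scale_sub_ge hw (x := x) (y := 2 * x) (by linarith)
  have h2 := scale_le_total hw (2 * x)
  have e : 2 * x - x = x := by ring
  rw [e] at h1
  linarith

lemma mul_le_weight_mul_scaleTotal_sub (ha : 0 < a) {κ α : ℝ} (hκ : 0 < κ)
    (hpow : ∀ x, a ≤ x → κ⁻¹ * x ^ α ≤ w x ∧ w x ≤ κ * x ^ α) {x : ℝ} (hx : a ≤ x) :
    (κ ^ 2 * 2 ^ α)⁻¹ * x ≤ w x * (scaleTotal w a - scale w a x) := by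
  have hx0 : 0 < x := ha.trans_le hx
  have h1 := div_le_scaleTotal_sub hw hx0.le
  have h2 := (hpow (2 * x) (by linarith)).2
  have h3 := (hpow x hx).1
  have hw2 := hw.pos (2 * x)
  have hxα : 0 < x ^ α := Real.rpow_pos_of_pos hx0 α
  rw [Real.mul_rpow zero_le_two hx0.le] at h2
  have h2α : (0 : ℝ) < 2 ^ α := Real.rpow_pos_of_pos two_pos α
  calc (κ ^ 2 * 2 ^ α)⁻¹ * x = κ⁻¹ * x ^ α * (x / (κ * (2 ^ α * x ^ α))) := by field_simp
    _ ≤ w x * (x / w (2 * x)) := by gcongr; exact (hw.pos x).le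
    _ ≤ _ := mul_le_mul_of_nonneg_left h1 (hw.pos x).le

lemma scaleTotal_sub_le (ha : 0 < a) {κ α : ℝ} (hκ : 0 < κ) (hα : 1 < α)
    (hpow : ∀ x, a ≤ x → κ⁻¹ * x ^ α ≤ w x) {x : ℝ} (hx : a ≤ x) :
    scaleTotal w a - scale w a x ≤ κ / (α - 1) * x ^ (1 - α) := by
  have hx0 : 0 < x := ha.trans_le hx
  have hix := hw.integrableOn.mono_set (Set.Ioi_subset_Ioi hx)
  have h1 : scaleTotal w a - scale w a x = ∫ t in Set.Ioi x, (w t)⁻¹ := by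
    unfold scaleTotal scale
    rw [← intervalIntegral.integral_interval_add_Ioi hw.integrableOn hix]
    ring
  have hi := (integrableOn_Ioi_rpow_of_lt (a := -α) (by linarith) hx0).const_mul κ
  have h2 : ∫ t in Set.Ioi x, (w t)⁻¹ ≤ ∫ t in Set.Ioi x, κ * t ^ (-α) := by
    refine setIntegral_mono_on hix hi measurableSet_Ioi fun t ht => ?_
    have ht' : x < t := ht
    have ht0 : 0 < t := hx0.trans ht'
    have h := hpow t (hx.trans ht'.le)
    have htα : 0 < t ^ α := Real.rpow_pos_of_pos ht0 α
    calc (w t)⁻¹ ≤ (κ⁻¹ * t ^ α)⁻¹ := inv_anti₀ (by positivity) h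
      _ = κ * t ^ (-α) := by rw [mul_inv, inv_inv, Real.rpow_neg ht0.le]
  rw [h1]
  refine h2.trans (le_of_eq ?_)
  rw [integral_const_mul, integral_Ioi_rpow_of_lt (by linarith) hx0,
    show -α + 1 = -(α - 1) by ring, show 1 - α = -(α - 1) by ring, neg_div_neg_eq]
  ring

lemma exists_scaleTotal_sub_mul_le (ha : 0 < a) {κ α : ℝ} (hκ : 0 < κ) (hα : 1 < α)
    (hpow : ∀ x, a ≤ x → κ⁻¹ * x ^ α ≤ w x ∧ w x ≤ κ * x ^ α) :
    ∃ Γ : ℝ, 1 ≤ Γ ∧ ∀ x, a ≤ x →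
      scaleTotal w a - scale w a (Γ * x) ≤ (scaleTotal w a - scale w a x) / 2 := by
  have h2α : (0 : ℝ) < 2 ^ α := Real.rpow_pos_of_pos two_pos α
  have hlim : Tendsto (fun Γ : ℝ => κ / (α - 1) * Γ ^ (-(α - 1))) atTop (𝓝 0) := by
    simpa using (tendsto_rpow_neg_atTop (sub_pos.2 hα)).const_mul (κ / (α - 1))
  obtain ⟨Γ, hΓ, hΓ1⟩ := ((hlim.eventually (gt_mem_nhds
    (show (0 : ℝ) < (κ * 2 ^ α)⁻¹ / 2 by positivity))).and (eventually_ge_atTop 1)).exists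
  refine ⟨Γ, hΓ1, fun x hx => ?_⟩
  have hx0 : 0 < x := ha.trans_le hx
  have hΓ0 : 0 < Γ := by linarith
  have h1 := scaleTotal_sub_le hw ha hκ hα (fun x hx => (hpow x hx).1) (x := Γ * x)
    (by nlinarith)
  have h2 := div_le_scaleTotal_sub hw hx0.le
  have h3 := (hpow (2 * x) (by linarith)).2
  have hw2 := hw.pos (2 * x)
  have hxα : 0 < x ^ α := Real.rpow_pos_of_pos hx0 α
  rw [Real.mul_rpow zero_le_two hx0.le] at h3
  have h4 : x / (κ * (2 ^ α * x ^ α)) ≤ x / w (2 * x) :=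
    div_le_div_of_nonneg_left hx0.le hw2 h3
  have h5 : x ^ (1 - α) = x / x ^ α := by rw [Real.rpow_sub hx0, Real.rpow_one]
  have h6 : x / (κ * (2 ^ α * x ^ α)) = (κ * 2 ^ α)⁻¹ * x ^ (1 - α) := by
    rw [h5]; field_simp
  have h7 : 0 < x ^ (1 - α) := Real.rpow_pos_of_pos hx0 _
  rw [Real.mul_rpow hΓ0.le hx0.le, ← mul_assoc, show Γ ^ (1 - α) = Γ ^ (-(α - 1)) by
    congr 1; ring] at h1
  have h8 := mul_le_mul_of_nonneg_right hΓ.le h7.le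
  linarith

end PowerLaw

/-! ### Local times along a path -/

section Path

variable {Ω V : Type*} {ℓ : V → ℝ} {τ : ℕ → Ω → ℝ≥0} {Y : ℕ → Ω → V}

/-- Along the path `x`, the jump times and the visited vertices are those given by `τ` and `Y`
at `ω`. -/
structure IsPathOf (τ : ℕ → Ω → ℝ≥0) (Y : ℕ → Ω → V) (ω : Ω) (x : ℝ≥0 → V) : Prop where
  zero : τ 0 ω = 0
  strictMono : StrictMono fun n => τ n ω
  tendsto : Tendsto (fun n => τ n ω) atTop atTop
  eq_vertex : ∀ n t, τ n ω ≤ t → t < τ (n + 1) ω → x t = Y n ω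

variable {ω : Ω} {x : ℝ≥0 → V} (hx : IsPathOf τ Y ω x)
include hx

lemma IsPathOf.integral_indicator (v : V) {n : ℕ} {t : ℝ≥0} (h1 : τ n ω ≤ t)
    (h2 : t ≤ τ (n + 1) ω) :
    IntervalIntegrable (Set.indicator {r : ℝ | x r.toNNReal = v} (fun _ => (1 : ℝ))) volume
      (τ n ω) t ∧
    ∫ s in (τ n ω : ℝ)..(t : ℝ), Set.indicator {r : ℝ | x r.toNNReal = v} (fun _ => (1 : ℝ)) s
      = if Y n ω = v then (t : ℝ) - τ n ω else 0 := by
  have hle : (τ n ω : ℝ) ≤ t := NNReal.coe_le_coe.2 h1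
  have heq : Set.EqOn (fun _ => if Y n ω = v then (1 : ℝ) else 0)
      (Set.indicator {r : ℝ | x r.toNNReal = v} (fun _ => (1 : ℝ)))
      (Set.uIoo (τ n ω : ℝ) (t : ℝ)) := by
    intro r hr
    rw [Set.uIoo_of_le hle] at hr
    have hr0 : 0 ≤ r := (τ n ω).coe_nonneg.trans hr.1.le
    have hxr : x r.toNNReal = Y n ω := by
      refine hx.eq_vertex n _ ?_ ?_
      · rw [← NNReal.coe_le_coe, Real.coe_toNNReal r hr0]; exact hr.1.le
      · rw [← NNReal.coe_lt_coe, Real.coe_toNNReal r hr0]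
        exact hr.2.trans_le (NNReal.coe_le_coe.2 h2)
    simp only [Set.indicator_apply, Set.mem_ofPred_eq, hxr]
  refine ⟨IntervalIntegrable.congr_uIoo (by simp) heq, ?_⟩
  rw [← intervalIntegral.integral_congr_uIoo heq, intervalIntegral.integral_const]
  split_ifs <;> simp

lemma IsPathOf.integral_zero_indicator (v : V) (n : ℕ) :
    IntervalIntegrable (Set.indicator {r : ℝ | x r.toNNReal = v} (fun _ => (1 : ℝ))) volume
      0 (τ n ω) ∧
    localTime ℓ x v (τ n ω) = chainTime ℓ τ Y n ω v := by
  induction n with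
  | zero => simp [localTime, chainTime, hx.zero]
  | succ n ih =>
    have hlt : τ n ω < τ (n + 1) ω := hx.strictMono n.lt_succ_self
    obtain ⟨h1, h2⟩ := hx.integral_indicator v hlt.le le_rfl
    refine ⟨ih.1.trans h1, ?_⟩
    have h3 := ih.2
    simp only [localTime, chainTime, Finset.sum_range_succ] at h3 ⊢
    rw [← intervalIntegral.integral_add_adjacent_intervals ih.1 h1, h2, hold,
      NNReal.coe_sub hlt.le, ← add_assoc, h3, add_assoc]

lemma IsPathOf.localTime_jump (v : V) (n : ℕ) :
    localTime ℓ x v (τ n ω) = chainTime ℓ τ Y n ω v := (hx.integral_zero_indicator v n).2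

lemma IsPathOf.localTime_eq (v : V) {n : ℕ} {t : ℝ≥0} (h1 : τ n ω ≤ t)
    (h2 : t ≤ τ (n + 1) ω) :
    localTime ℓ x v t = chainTime ℓ τ Y n ω v + if Y n ω = v then (t : ℝ) - τ n ω else 0 := by
  obtain ⟨h3, h4⟩ := hx.integral_indicator v h1 h2
  rw [← hx.localTime_jump v n]
  simp only [localTime]
  rw [← intervalIntegral.integral_add_adjacent_intervals (hx.integral_zero_indicator
    (ℓ := ℓ) v n).1 h3, h4, ← add_assoc]

lemma IsPathOf.chainTime_le_localTime (v : V) {n : ℕ} {t : ℝ≥0} (h1 : τ n ω ≤ t)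
    (h2 : t ≤ τ (n + 1) ω) : chainTime ℓ τ Y n ω v ≤ localTime ℓ x v t := by
  rw [hx.localTime_eq v h1 h2]
  have : (τ n ω : ℝ) ≤ t := NNReal.coe_le_coe.2 h1
  split_ifs <;> linarith

lemma IsPathOf.localTime_le_chainTime (v : V) {n : ℕ} {t : ℝ≥0} (h1 : τ n ω ≤ t)
    (h2 : t ≤ τ (n + 1) ω) : localTime ℓ x v t ≤ chainTime ℓ τ Y (n + 1) ω v := by
  rw [hx.localTime_eq v h1 h2, ← hx.localTime_jump (ℓ := ℓ) v (n + 1),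
    hx.localTime_eq v (h1.trans h2) le_rfl]
  have : (t : ℝ) ≤ τ (n + 1) ω := NNReal.coe_le_coe.2 h2
  split_ifs <;> linarith

lemma IsPathOf.exists_index {n₀ : ℕ} {t : ℝ≥0} (ht : τ n₀ ω ≤ t) :
    ∃ n, n₀ ≤ n ∧ τ n ω ≤ t ∧ t < τ (n + 1) ω := by
  have hex : ∃ m, t < τ m ω := (hx.tendsto.eventually_gt_atTop t).exists
  have hspec := Nat.find_spec hex
  have hlt : n₀ < Nat.find hex := by
    by_contra h
    exact absurd (hspec.trans_le (hx.strictMono.monotone (not_lt.1 h))) (not_lt.2 ht)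
  obtain ⟨n, hn⟩ : ∃ n, Nat.find hex = n + 1 := ⟨Nat.find hex - 1, by omega⟩
  refine ⟨n, by omega, ?_, hn ▸ hspec⟩
  exact not_lt.1 (Nat.find_min hex (by omega))

lemma IsPathOf.mem_unboundedSet_iff (v : V) :
    v ∈ unboundedSet ℓ x ↔ Tendsto (fun n => chainTime ℓ τ Y n ω v) atTop atTop := by
  constructor
  · intro h
    have h' : Tendsto (localTime ℓ x v) atTop atTop := h
    have := h'.comp hx.tendsto
    exact this.congr fun n => hx.localTime_jump v n
  · intro h
    change Tendsto (localTime ℓ x v) atTop atTop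
    refine tendsto_atTop.2 fun b => ?_
    obtain ⟨n₀, hn₀⟩ := eventually_atTop.1 (h.eventually_ge_atTop b)
    filter_upwards [eventually_ge_atTop (τ n₀ ω)] with t ht
    obtain ⟨n, hn, h1, h2⟩ := hx.exists_index ht
    exact (hn₀ n hn).trans (hx.chainTime_le_localTime v h1 h2.le)

lemma IsPathOf.le_localTime {a : ℝ} (hℓ : ∀ v, a ≤ ℓ v) (v : V) (t : ℝ≥0) :
    a ≤ localTime ℓ x v t := by
  obtain ⟨n, -, h1, h2⟩ := hx.exists_index (n₀ := 0) (t := t) (by rw [hx.zero]; exact zero_le)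
  exact (le_chainTime hℓ n ω v).trans (hx.chainTime_le_localTime v h1 h2.le)

/-- A comparison of local times after each jump holds at all times: between two jumps, at most one
of the two local times grows. -/
lemma IsPathOf.eventually_localTime_le {i k : V} (hik : i ≠ k) {Γ : ℝ} (hΓ : 0 ≤ Γ)
    (h : ∀ᶠ n in atTop, chainTime ℓ τ Y n ω k ≤ Γ * chainTime ℓ τ Y n ω i) :
    ∀ᶠ t in atTop, localTime ℓ x k t ≤ Γ * localTime ℓ x i t := by
  obtain ⟨n₀, hn₀⟩ := eventually_atTop.1 h
  filter_upwards [eventually_ge_atTop (τ n₀ ω)] with t ht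
  obtain ⟨n, hn, h1, h2⟩ := hx.exists_index ht
  by_cases hk : Y n ω = k
  · have hi : localTime ℓ x i t = chainTime ℓ τ Y (n + 1) ω i := by
      have hne : Y n ω ≠ i := fun h => hik (h.symm.trans hk)
      rw [hx.localTime_eq i h1 h2.le, if_neg hne, ← hx.localTime_jump (ℓ := ℓ) i (n + 1),
        hx.localTime_eq i (h1.trans h2.le) le_rfl, if_neg hne]
    rw [hi]
    exact (hx.localTime_le_chainTime k h1 h2.le).trans (hn₀ (n + 1) (by omega))
  · have hk' : localTime ℓ x k t = chainTime ℓ τ Y n ω k := by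
      rw [hx.localTime_eq k h1 h2.le, if_neg hk, add_zero]
    rw [hk']
    exact (hn₀ n hn).trans (mul_le_mul_of_nonneg_left (hx.chainTime_le_localTime i h1 h2.le) hΓ)

end Path

/-! ### The jump chain of a vertex-reinforced jump process -/

section OfVRJP

variable {Ω V : Type*} [Fintype V] [Nontrivial V] [MeasurableSpace Ω] {G : SimpleGraph V}
  {w : ℝ → ℝ} {a : ℝ} {ℓ : V → ℝ} {μ : Measure Ω} [IsProbabilityMeasure μ] {X : ℝ≥0 → Ω → V}

/-- The rates only depend on the values of `w` on `[a, ∞)`, hence `w` may be replaced by its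
extension which is constant on `(-∞, a]`. -/
lemma IsVRJP.exists_isJumpChain (hG : G.Connected) (hw : IsStrongWeight a fun x => w (max a x))
    (hℓ : ∀ v, a ≤ ℓ v) (hX : IsVRJP G ℓ w μ X) :
    ∃ (τ : ℕ → Ω → ℝ≥0) (Y : ℕ → Ω → V),
      IsJumpChain G (fun x => w (max a x)) ℓ μ τ Y ∧
      ∀ᵐ ω ∂μ, IsPathOf τ Y ω (fun t => X t ω) ∧ ∀ n, G.Adj (Y n ω) (Y (n + 1) ω) := by
  obtain ⟨-, τ, Y, hτ, hY, hpath, hlaw⟩ := hX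
  have hpath' : ∀ᵐ ω ∂μ, IsPathOf τ Y ω (fun t => X t ω) ∧
      ∀ n, G.Adj (Y n ω) (Y (n + 1) ω) := by
    filter_upwards [hpath] with ω h
    exact ⟨⟨h.1, h.2.1, h.2.2.1, h.2.2.2.2⟩, h.2.2.2.1⟩
  refine ⟨τ, Y, ⟨hτ, hY, ?_, ?_⟩, hpath'⟩
  · filter_upwards [hpath'] with ω h n using h.1.strictMono n.lt_succ_self
  · intro n H hH v s
    have hle := history_le hτ hY n
    have hH' : MeasurableSet H := hle H hH
    set S : Set Ω := {ω | τ n ω + s < τ (n + 1) ω ∧ Y (n + 1) ω = v} with hS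
    have hSm : MeasurableSet S :=
      (measurableSet_lt ((hτ n).add_const s) (hτ (n + 1))).inter (hY (n + 1) (t := {v}) trivial)
    set F : Ω → ℝ := fun ω => rate G (fun x => w (max a x)) (chainTime ℓ τ Y n ω) (Y n ω) v
          / totalRate G (fun x => w (max a x)) (chainTime ℓ τ Y n ω) (Y n ω)
          * Real.exp (-(s * totalRate G (fun x => w (max a x)) (chainTime ℓ τ Y n ω) (Y n ω)))
      with hF
    have hWpos : ∀ ω u, 0 < totalRate G (fun x => w (max a x)) (chainTime ℓ τ Y n ω) u :=
      fun ω u => (hw.pos a).trans_le (le_totalRate hw hG (le_chainTime hℓ n ω) u)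
    have hF0 : ∀ ω, 0 ≤ F ω := fun ω => mul_nonneg
      (div_nonneg (rate_nonneg hw _ _ _) (hWpos ω _).le) (Real.exp_pos _).le
    have hF1 : ∀ ω, F ω ≤ 1 := fun ω => by
      refine mul_le_one₀ ?_ (Real.exp_pos _).le ?_
      · exact (div_le_one (hWpos ω _)).2 (Finset.single_le_sum
          (f := fun u => rate G (fun x => w (max a x)) (chainTime ℓ τ Y n ω) (Y n ω) u)
          (fun u _ => rate_nonneg hw _ _ u) (Finset.mem_univ v))
      · rw [Real.exp_le_one_iff, neg_nonpos]
        exact mul_nonneg s.coe_nonneg (hWpos ω _).le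
    have hLm : Measurable (chainTime ℓ τ Y n) := (measurable_chainTime le_rfl).mono hle le_rfl
    have hFm : Measurable F := by
      refine measurable_vertex_comp (Z := Y n) (fun u => hY n (t := {u}) trivial)
        (F := fun u ω => rate G (fun x => w (max a x)) (chainTime ℓ τ Y n ω) u v
          / totalRate G (fun x => w (max a x)) (chainTime ℓ τ Y n ω) u
          * Real.exp (-(s * totalRate G (fun x => w (max a x)) (chainTime ℓ τ Y n ω) u)))
        fun u => ?_
      have h1 := (measurable_rate (G := G) hw u v).comp hLm
      have h2 := (measurable_totalRate (G := G) hw u).comp hLm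
      exact (h1.div h2).mul (Real.measurable_exp.comp (h2.const_mul (s : ℝ)).neg)
    have hFi : Integrable F μ := Integrable.of_bound hFm.aestronglyMeasurable 1
      (ae_of_all _ fun ω => by rw [Real.norm_eq_abs, abs_of_nonneg (hF0 ω)]; exact hF1 ω)
    have hind : Integrable (S.indicator fun _ => (1 : ℝ)) μ :=
      (integrable_const (1 : ℝ)).indicator hSm
    have heq : (fun ω => F ω) =ᵐ[μ] μ[S.indicator (fun _ => (1 : ℝ)) | history τ Y n] := by
      filter_upwards [hlaw n v s, hpath'] with ω h1 h2
      rw [h1]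
      have hrate : ∀ u, jumpRate G ℓ w (fun t => X t ω) (Y n ω) (τ n ω) u
          = rate G (fun x => w (max a x)) (chainTime ℓ τ Y n ω) (Y n ω) u := by
        intro u
        simp only [jumpRate, rate, Set.indicator_apply, Set.mem_ofPred_eq,
          h2.1.localTime_jump (ℓ := ℓ) u n, max_eq_right (le_chainTime hℓ n ω u)]
      simp only [hrate, hF, totalRate]
    have hint : ∫ ω in H, F ω ∂μ = μ.real (H ∩ S) := by
      rw [setIntegral_congr_ae hH' (heq.mono fun ω h _ => h), setIntegral_condExp hle hind hH,
        setIntegral_indicator hSm, setIntegral_const, smul_eq_mul, mul_one]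
    rw [← ofReal_integral_eq_lintegral_ofReal hFi.integrableOn (ae_of_all _ hF0), hint,
      ofReal_measureReal]

end OfVRJP

/-! ### Clusters -/

section Cluster

variable {V : Type*} {G : SimpleGraph V} {S U : Set V}

lemma IsCluster.subset (hU : IsCluster G S U) : U ⊆ S := by
  obtain ⟨c, rfl⟩ := hU
  rintro _ ⟨v, -, rfl⟩
  exact v.2

lemma IsCluster.nonempty (hU : IsCluster G S U) : U.Nonempty := by
  obtain ⟨c, rfl⟩ := hU
  exact c.nonempty_supp.image _

lemma IsCluster.mem_of_adj (hU : IsCluster G S U) {x y : V} (hx : x ∈ U) (hy : y ∈ S)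
    (hxy : G.Adj x y) : y ∈ U := by
  obtain ⟨c, rfl⟩ := hU
  obtain ⟨v, hv, rfl⟩ := hx
  have h : (G.induce S).Adj v ⟨y, hy⟩ := hxy
  exact ⟨⟨y, hy⟩, c.mem_supp_of_adj_mem_supp hv h, rfl⟩

lemma IsCluster.eq_of_mem {U' : Set V} (hU : IsCluster G S U) (hU' : IsCluster G S U') {x : V}
    (hx : x ∈ U) (hx' : x ∈ U') : U = U' := by
  obtain ⟨c, rfl⟩ := hU
  obtain ⟨c', rfl⟩ := hU'
  obtain ⟨v, hv, rfl⟩ := hx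
  obtain ⟨v', hv', h⟩ := hx'
  rw [Subtype.ext h] at hv'
  rw [SimpleGraph.ConnectedComponent.mem_supp_iff] at hv hv'
  rw [← hv, ← hv']

/-- Two vertices of a cluster are joined, inside `S`, by a walk of length at most the number of
vertices. -/
lemma IsCluster.exists_walk [Fintype V] (hU : IsCluster G S U) {x y : V} (hx : x ∈ U)
    (hy : y ∈ U) : ∃ (hx' : x ∈ S) (hy' : y ∈ S) (p : (G.induce S).Walk ⟨x, hx'⟩ ⟨y, hy'⟩),
      p.length ≤ Fintype.card V := by
  refine ⟨hU.subset hx, hU.subset hy, ?_⟩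
  obtain ⟨c, rfl⟩ := hU
  obtain ⟨v, hv, rfl⟩ := hx
  obtain ⟨v', hv', rfl⟩ := hy
  rw [SimpleGraph.ConnectedComponent.mem_supp_iff] at hv hv'
  obtain ⟨p⟩ := SimpleGraph.ConnectedComponent.exact (hv.trans hv'.symm)
  have h1 : p.bypass.length < Fintype.card S := p.bypass_isPath.length_lt
  exact ⟨p.bypass, h1.le.trans (Fintype.card_le_of_injective _ Subtype.val_injective)⟩

lemma two_le_setDist (hU : IsCluster G S U) : 2 ≤ setDist G U (S \ U) := by
  refine le_iInf₂ fun x hx => le_iInf₂ fun y hy => ?_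
  by_contra h
  have h1 : G.edist x y ≤ 1 := Order.le_of_lt_add_one (by simpa [one_add_one_eq_two] using h)
  rcases SimpleGraph.edist_le_one_iff_adj_or_eq.1 h1 with h2 | h2
  · exact hy.2 (hU.mem_of_adj hx hy.1 h2)
  · exact hy.2 (h2 ▸ hx)

end Cluster

/-! ### Pathwise conclusions -/

section Final

variable {Ω V : Type*} [Fintype V] {G : SimpleGraph V} {ℓ : V → ℝ} {τ : ℕ → Ω → ℝ≥0}
  {Y : ℕ → Ω → V} {ω : Ω}

omit [Fintype V] in
lemma frequently_eq_of_tendsto {v : V}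
    (h : Tendsto (fun n => chainTime ℓ τ Y n ω v) atTop atTop) : ∃ᶠ n in atTop, Y n ω = v := by
  intro hev
  obtain ⟨N, hN⟩ := eventually_atTop.1 hev
  have hconst : ∀ n, N ≤ n → chainTime ℓ τ Y n ω v = chainTime ℓ τ Y N ω v := by
    intro n hn
    induction n, hn using Nat.le_induction with
    | base => rfl
    | succ n hn ih =>
      rw [← ih]
      simp only [chainTime, Finset.sum_range_succ, if_neg (hN n hn), add_zero]
  obtain ⟨n, h1, h2⟩ := ((h.eventually_gt_atTop (chainTime ℓ τ Y N ω v)).and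
    (eventually_ge_atTop N)).exists
  exact absurd (hconst n h2) h1.ne'

omit [Fintype V] in
lemma exists_nat_bound_of_not_tendsto {v : V}
    (h : ¬ Tendsto (fun n => chainTime ℓ τ Y n ω v) atTop atTop) :
    ∃ K : ℕ, ∀ n, chainTime ℓ τ Y n ω v ≤ K := by
  rcases tendsto_atTop_of_monotone (chainTime_mono (ℓ := ℓ) (τ := τ) (Y := Y) ω v) with h' | ⟨l, hl⟩
  · exact absurd h' h
  · obtain ⟨K, hK⟩ := exists_nat_ge l
    exact ⟨K, fun n => ((chainTime_mono ω v).ge_of_tendsto hl n).trans hK⟩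

/-- If eventually no jump connects two vertices with bounded local times, then the last exit from a
cluster `U` before a late visit to another vertex of `V*` reaches `V* \ U` in two jumps. -/
lemma setDist_eq_two {x : ℝ≥0 → V} (hx : IsPathOf τ Y ω x) (hadj : ∀ n, G.Adj (Y n ω) (Y (n + 1) ω))
    (hjump : ∀ y z : V, ∀ K : ℕ, ∀ᶠ n in atTop, ¬ ((Y n ω = y ∧ chainTime ℓ τ Y n ω y ≤ K ∧
      chainTime ℓ τ Y n ω z ≤ K) ∧ Y (n + 1) ω = z))
    {U : Set V} (hU : IsCluster G (unboundedSet ℓ x) U)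
    (hne : (unboundedSet ℓ x \ U).Nonempty) : setDist G U (unboundedSet ℓ x \ U) = 2 := by
  refine le_antisymm ?_ (two_le_setDist hU)
  have hev : ∀ᶠ n in atTop, ∀ y z, ¬ ((y ∉ unboundedSet ℓ x ∧ z ∉ unboundedSet ℓ x) ∧
      (Y n ω = y ∧ Y (n + 1) ω = z)) := by
    refine eventually_all.2 fun y => eventually_all.2 fun z => ?_
    by_cases hyz : y ∉ unboundedSet ℓ x ∧ z ∉ unboundedSet ℓ x
    · rw [hx.mem_unboundedSet_iff, hx.mem_unboundedSet_iff] at hyz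
      obtain ⟨K, hK⟩ := exists_nat_bound_of_not_tendsto hyz.1
      obtain ⟨K', hK'⟩ := exists_nat_bound_of_not_tendsto hyz.2
      filter_upwards [hjump y z (max K K')] with n hn h
      refine hn ⟨⟨h.2.1, (hK n).trans ?_, (hK' n).trans ?_⟩, h.2.2⟩
      · exact_mod_cast le_max_left K K'
      · exact_mod_cast le_max_right K K'
    · exact Eventually.of_forall fun n h => hyz h.1
  obtain ⟨N, hN⟩ := eventually_atTop.1 hev
  obtain ⟨u, hu⟩ := hU.nonempty
  obtain ⟨y, hyS, hyU⟩ := hne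
  obtain ⟨n₁, hn₁, hYn₁⟩ := frequently_atTop.1 (frequently_eq_of_tendsto
    ((hx.mem_unboundedSet_iff u).1 (hU.subset hu))) N
  obtain ⟨n₂, hn₂, hYn₂⟩ := frequently_atTop.1 (frequently_eq_of_tendsto
    ((hx.mem_unboundedSet_iff y).1 hyS)) n₁
  -- the last visit to `U` before the visit to `y`
  set m := Nat.findGreatest (fun m => Y m ω ∈ U) n₂ with hm
  have hm1 : n₁ ≤ m := Nat.le_findGreatest hn₂ (by rw [hYn₁]; exact hu)
  have hm2 : m ≤ n₂ := Nat.findGreatest_le n₂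
  have hmU : Y m ω ∈ U :=
    Nat.findGreatest_spec (P := fun m => Y m ω ∈ U) hn₂ (by rw [hYn₁]; exact hu)
  have hlast : ∀ j, m < j → j ≤ n₂ → Y j ω ∉ U := fun j h1 h2 =>
    Nat.findGreatest_is_greatest h1 h2
  have hmne : m ≠ n₂ := by
    intro h; rw [h, hYn₂] at hmU; exact hyU hmU
  have h1 : Y (m + 1) ω ∉ unboundedSet ℓ x := fun h =>
    hlast (m + 1) m.lt_succ_self (by omega) (hU.mem_of_adj hmU h (hadj m))
  have hm1ne : m + 1 ≠ n₂ := by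
    intro h; rw [h, hYn₂] at h1; exact h1 hyS
  have h2 : Y (m + 2) ω ∈ unboundedSet ℓ x := by
    by_contra h
    exact hN (m + 1) (by omega) _ _ ⟨⟨h1, h⟩, rfl, rfl⟩
  have h3 : Y (m + 2) ω ∉ U := hlast (m + 2) (by omega) (by omega)
  refine (iInf₂_le (Y m ω) hmU).trans ((iInf₂_le (Y (m + 2) ω) ⟨h2, h3⟩).trans ?_)
  exact SimpleGraph.edist_le (.cons (hadj m) (.cons (hadj (m + 1)) .nil))

/-- Chaining the comparison of local times along the edges of a walk. -/
lemma eventually_localTime_le_pow {x : ℝ≥0 → V} {a Γ : ℝ} (ha : 0 < a) (hΓ : 1 ≤ Γ)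
    (hx : IsPathOf τ Y ω x)
    (hcmp : ∀ i k, G.Adj i k → Tendsto (fun n => chainTime ℓ τ Y n ω i) atTop atTop →
      ∀ᶠ n in atTop, chainTime ℓ τ Y n ω k < Γ * chainTime ℓ τ Y n ω i)
    {U : Set V} (hU : IsCluster G (unboundedSet ℓ x) U) (hℓ : ∀ v, a ≤ ℓ v) {i j : V} (hi : i ∈ U)
    (hj : j ∈ U) :
    ∀ᶠ t in atTop, localTime ℓ x j t ≤ Γ ^ Fintype.card V * localTime ℓ x i t := by
  obtain ⟨hi', hj', p, hp⟩ := hU.exists_walk hi hj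
  have key : ∀ (u v : unboundedSet ℓ x) (p : (G.induce (unboundedSet ℓ x)).Walk u v),
      ∀ᶠ t in atTop, localTime ℓ x v t ≤ Γ ^ p.length * localTime ℓ x u t := by
    intro u v p
    induction p with
    | nil => simp
    | @cons u v z huv p ih =>
      have h1 : ∀ᶠ t in atTop, localTime ℓ x v t ≤ Γ * localTime ℓ x u t := by
        have hadj : G.Adj u v := huv
        refine hx.eventually_localTime_le hadj.ne (by linarith) ?_
        filter_upwards [hcmp u v hadj ((hx.mem_unboundedSet_iff _).1 u.2)] with n hn using hn.le
      filter_upwards [ih, h1] with t h2 h3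
      rw [SimpleGraph.Walk.length_cons, pow_succ, mul_assoc]
      exact h2.trans (mul_le_mul_of_nonneg_left h3 (by positivity))
  filter_upwards [key _ _ p] with t ht
  refine ht.trans (mul_le_mul_of_nonneg_right (pow_le_pow_right₀ hΓ hp) ?_)
  exact ha.le.trans (hx.le_localTime hℓ i t)

lemma le_liminf_localTime_div {x : ℝ≥0 → V} {a Γ : ℝ} (ha : 0 < a) (hΓ : 1 ≤ Γ)
    (hx : IsPathOf τ Y ω x)
    (hcmp : ∀ i k, G.Adj i k → Tendsto (fun n => chainTime ℓ τ Y n ω i) atTop atTop →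
      ∀ᶠ n in atTop, chainTime ℓ τ Y n ω k < Γ * chainTime ℓ τ Y n ω i)
    {U : Set V} (hU : IsCluster G (unboundedSet ℓ x) U) (hℓ : ∀ v, a ≤ ℓ v) {i : V} (hi : i ∈ U) :
    1 / (Fintype.card V * Γ ^ Fintype.card V)
      ≤ liminf (fun t : ℝ≥0 => localTime ℓ x i t / setLocalTime ℓ x U t) atTop := by
  have hpos : ∀ v t, 0 < localTime ℓ x v t := fun v t => ha.trans_le (hx.le_localTime hℓ v t)
  have hle : ∀ t, localTime ℓ x i t ≤ setLocalTime ℓ x U t := by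
    intro t
    have h := Finset.single_le_sum (f := fun v => U.indicator (fun u => localTime ℓ x u t) v)
      (fun v _ => Set.indicator_nonneg (fun u _ => (hpos u t).le) v) (Finset.mem_univ i)
    exact (Set.indicator_of_mem hi (fun u => localTime ℓ x u t)).symm.le.trans h
  refine le_liminf_of_le ?_ ?_
  · refine (isBoundedUnder_of ⟨1, fun t => ?_⟩).isCoboundedUnder_ge
    exact (div_le_one ((hpos i t).trans_le (hle t))).2 (hle t)
  · have hall : ∀ᶠ t in atTop, ∀ j, j ∈ U →
        localTime ℓ x j t ≤ Γ ^ Fintype.card V * localTime ℓ x i t := by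
      refine eventually_all.2 fun j => ?_
      by_cases hj : j ∈ U
      · filter_upwards [eventually_localTime_le_pow ha hΓ hx hcmp hU hℓ hi hj] with t ht _ using ht
      · exact Eventually.of_forall fun t h => absurd h hj
    filter_upwards [hall] with t ht
    have hcard : (0 : ℝ) < Fintype.card V := by
      exact_mod_cast Fintype.card_pos_iff.2 ⟨i⟩
    have hΓ0 : 0 < Γ := by linarith
    rw [div_le_div_iff₀ (by positivity) ((hpos i t).trans_le (hle t)), one_mul]
    calc setLocalTime ℓ x U t
        ≤ ∑ _v : V, Γ ^ Fintype.card V * localTime ℓ x i t := by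
          refine Finset.sum_le_sum fun v _ => ?_
          by_cases hv : v ∈ U
          · rw [Set.indicator_of_mem hv]; exact ht v hv
          · rw [Set.indicator_of_notMem hv]
            exact mul_nonneg (by positivity) (hpos i t).le
      _ = _ := by rw [Finset.sum_const, nsmul_eq_mul, Finset.card_univ]; ring

end Final

end

end VRJP

theorem corollary5p7 {V : Type*} [Fintype V] [Nontrivial V] (G : SimpleGraph V)
    (hG : G.Connected) (a : ℝ) (ha : 0 < a) (w : ℝ → ℝ)
    (hw_pos : ∀ x, a ≤ x → 0 < w x)
    (hw_mono : MonotoneOn w (Set.Ici a))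
    (hw_int : IntegrableOn (fun x => 1 / w x) (Set.Ici a))
    (hw_diff : DifferentiableOn ℝ w (Set.Ici a))
    (hw_pow : ∃ κ α : ℝ, 1 < κ ∧ 1 < α ∧ ∀ x, a ≤ x → κ⁻¹ * x ^ α ≤ w x ∧ w x ≤ κ * x ^ α) :
    ∃ γ₀ : ℝ, 0 < γ₀ ∧
      ∀ (ℓ : V → ℝ), (∀ v, a ≤ ℓ v) →
      ∀ {Ω : Type*} [MeasurableSpace Ω] (μ : Measure Ω) [IsProbabilityMeasure μ]
        (X : ℝ≥0 → Ω → V), VRJP.IsVRJP G ℓ w μ X →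
      ∀ᵐ ω ∂μ,
        ((∃ U U', VRJP.IsCluster G (VRJP.unboundedSet ℓ (fun t => X t ω)) U ∧
            VRJP.IsCluster G (VRJP.unboundedSet ℓ (fun t => X t ω)) U' ∧ U ≠ U') →
          ∀ U, VRJP.IsCluster G (VRJP.unboundedSet ℓ (fun t => X t ω)) U →
            VRJP.setDist G U (VRJP.unboundedSet ℓ (fun t => X t ω) \ U) = 2) ∧
        (∀ U, VRJP.IsCluster G (VRJP.unboundedSet ℓ (fun t => X t ω)) U → ∀ i ∈ U,
          γ₀ ≤ liminf (fun t : ℝ≥0 => VRJP.localTime ℓ (fun r => X r ω) i t /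
            VRJP.setLocalTime ℓ (fun r => X r ω) U t) atTop) := by
  obtain ⟨κ, α, hκ, hα, hpow⟩ := hw_pow
  have hκ0 : 0 < κ := by linarith
  have hw : VRJP.IsStrongWeight a fun x => w (max a x) :=
    VRJP.isStrongWeight_max hw_pos hw_mono hw_int hw_diff.continuousOn
  have hpow' : ∀ x, a ≤ x → κ⁻¹ * x ^ α ≤ w (max a x) ∧ w (max a x) ≤ κ * x ^ α := by
    intro x hx
    rw [max_eq_right hx]
    exact hpow x hx
  obtain ⟨Γ, hΓ1, hΓ⟩ := VRJP.exists_scaleTotal_sub_mul_le hw ha hκ0 hα hpow'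
  have hlow := fun x => VRJP.mul_le_weight_mul_scaleTotal_sub hw ha hκ0 hpow' (x := x)
  have hc : 0 < (κ ^ 2 * 2 ^ α)⁻¹ := by
    have : (0 : ℝ) < 2 ^ α := Real.rpow_pos_of_pos two_pos α
    positivity
  have hcard : (0 : ℝ) < Fintype.card V := by exact_mod_cast Fintype.card_pos
  refine ⟨1 / (Fintype.card V * Γ ^ Fintype.card V), by positivity, ?_⟩
  intro ℓ hℓ Ω _ μ _ X hX
  obtain ⟨τ, Y, hJ, hpath⟩ := hX.exists_isJumpChain hG hw hℓ
  have hcmp : ∀ᵐ ω ∂μ, ∀ i k, G.Adj i k →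
      Tendsto (fun n => VRJP.chainTime ℓ τ Y n ω i) atTop atTop →
      ∀ᶠ n in atTop, VRJP.chainTime ℓ τ Y n ω k < Γ * VRJP.chainTime ℓ τ Y n ω i := by
    refine ae_all_iff.2 fun i => ae_all_iff.2 fun k => ?_
    by_cases hik : G.Adj i k
    · filter_upwards [VRJP.ae_eventually_chainTime_lt hw ha hG hℓ hJ hik hΓ1 hc hΓ hlow]
        with ω h _ using h
    · exact ae_of_all _ fun ω h => absurd h hik
  have hjump : ∀ᵐ ω ∂μ, ∀ y z : V, ∀ K : ℕ, ∀ᶠ n in atTop,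
      ¬ ((Y n ω = y ∧ VRJP.chainTime ℓ τ Y n ω y ≤ K ∧
        VRJP.chainTime ℓ τ Y n ω z ≤ K) ∧ Y (n + 1) ω = z) :=
    ae_all_iff.2 fun y => ae_all_iff.2 fun z => ae_all_iff.2 fun K =>
      VRJP.ae_not_frequently_jump hw hG hℓ hJ y z K
  filter_upwards [hpath, hcmp, hjump] with ω h1 h2 h3
  refine ⟨?_, fun U hU i hi => VRJP.le_liminf_localTime_div ha hΓ1 h1.1 h2 hU hℓ hi⟩
  rintro ⟨U₁, U₂, hU₁, hU₂, hne⟩ U hU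
  refine VRJP.setDist_eq_two h1.1 h1.2 h3 hU ?_
  have hother : ∀ U', VRJP.IsCluster G (VRJP.unboundedSet ℓ fun t => X t ω) U' → U' ≠ U →
      (VRJP.unboundedSet ℓ (fun t => X t ω) \ U).Nonempty := by
    intro U' hU' hne'
    obtain ⟨y, hy⟩ := hU'.nonempty
    exact ⟨y, hU'.subset hy, fun hyU => hne' (hU'.eq_of_mem hU hy hyU)⟩
  by_cases h : U₁ = U
  · exact hother U₂ hU₂ fun h' => hne (h.trans h'.symm)
  · exact hother U₁ hU₁ h
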